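/- Let $0\le b<1$, $c>0$, $\tau\ge 0$. For bounded $g:\mathbb R\to\mathbb R$ put $(Sg)(t)=g(t-c\tau)$ and $(Bg)(t)=\sum_{j\ge 0}b^{j}g(t-jc\tau)$, and let $$\chi_0(z)=z^2-cz+\frac{1}{1-be^{-zc\tau}} .$$ Suppose that $\varphi\in C^2(\mathbb R)$ is a bounded, monotone, non-constant solution of the problem $$\varphi''(t)-c\varphi'(t)+(B\varphi)(t)\bigl(1-(1-b)(SB\varphi)(t)\bigr)=0,\quad t\in\mathbb R,\qquad \varphi(-\infty)=0,\quad \varphi(+\infty)=1 .$$ Then $\varphi'(t)>0$ for all $t\in\mathbb R$, and $\chi_0$ has exactly two positive zeros $\lambda_2\le\lambda_1$, counted with multiplicity. Moreover, for some $\varepsilon>0$ and some $t_a,d\in\mathbb R$, $$\varphi(t+t_a)=e^{\lambda_2 t}\bigl((-t)^{j}+jd+o(e^{\varepsilon t})\bigr),\qquad t\to-\infty,$$ where $j=0$ if $\lambda_2<\lambda_1$ and $j=1$ if $\lambda_2=\lambda_1$. -/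

import Mathlib

open Filter Topology Asymptotics

noncomputable section

/-- The translation operator `(S g)(t) = g (t - c τ)`. -/
def shiftS (c τ : ℝ) (g : ℝ → ℝ) (t : ℝ) : ℝ :=
  g (t - c * τ)

/-- The operator `B = (I - b S)⁻¹ = ∑_{j ≥ 0} b ^ j S ^ j`, that is
`(B g)(t) = ∑_{j ≥ 0} b ^ j g (t - j c τ)`. It is used for bounded `g` and `0 ≤ b < 1` only, where
the series converges absolutely. -/
def neutralB (b c τ : ℝ) (g : ℝ → ℝ) (t : ℝ) : ℝ :=
  ∑' j : ℕ, b ^ j * g (t - j * (c * τ))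

/-- `w` is a `C²` solution of the boundary value problem
`w'' - c w' + (B w)(1 - (1 - b) S B w) = 0` on `ℝ`, `w(-∞) = 0`, `w(+∞) = 1`. -/
structure IsProfileSolution (b c τ : ℝ) (w : ℝ → ℝ) : Prop where
  contDiff : ContDiff ℝ 2 w
  equation : ∀ t : ℝ,
    deriv (deriv w) t - c * deriv w t
      + neutralB b c τ w t * (1 - (1 - b) * shiftS c τ (neutralB b c τ w) t) = 0
  tendsto_atBot : Tendsto w atBot (𝓝 0)
  tendsto_atTop : Tendsto w atTop (𝓝 1)

/-- The characteristic function `χ₀(z) = z² - c z + 1 / (1 - b e^{-z c τ})`. -/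
def chi0 (b c τ : ℝ) (z : ℂ) : ℂ :=
  z ^ 2 - c * z + 1 / (1 - b * Complex.exp (-z * c * τ))

end

/-!
Write `h = c τ`, `ψ = B φ` and `N = (1 - b) ψ (S ψ)`, so that the equation is `φ'' - c φ' + ψ = N`
with `φ = ψ - b S ψ` and `0 ≤ N ≤ ψ`. Since `φ' - c φ` is antitone and its limit at `-∞` cannot be
positive, `φ' ≤ c φ`: a front decays no faster than `e^{c t}` at `-∞`.

Multiplying by `e^{-x s}` and integrating over `s > t` gives a differential inequality for the tail
`∫ s > t, e^{-x s} φ s`. It first yields some exponential decay, and then improves the rate as long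
as `χ₀ > 0` on the rates reached. Without a zero of `χ₀` in `[0, c]` the decay would become faster
than `e^{c t}`, which is impossible; hence the function `χ₀`, strictly convex on `[0, ∞)`, has two
positive zeros `λ₂ ≤ λ₁`, and `φ` is `O(e^{μ t})` for all `μ < λ₂`.

The bilateral Laplace transforms satisfy `χ₀ · L φ = L N`. As `N` is quadratic, `L N` is holomorphic
on twice the strip of `L φ`, which therefore continues meromorphically beyond `Re z = λ₂`, where
`λ₂` is the only zero of `χ₀` in a thin strip. The operator `f ↦ f - λ₂ ∫_{-∞}^t f` multiplies the
transform by `(z - λ₂) / z`; applied once, or twice if the zero is double, it removes the pole, and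
moving the line of integration in the inversion formula to the right of `λ₂` shows that the reduced
function decays faster than `e^{λ₂ t}`. Undoing the reduction gives the expansion, whose leading
coefficient does not vanish because `L N λ₂ > 0`.
-/

open MeasureTheory Set

section Calculus

theorem antitone_exp_mul_of_deriv_le {f f' : ℝ → ℝ} {a : ℝ} (hf : ∀ t, HasDerivAt f (f' t) t)
    (hle : ∀ t, f' t ≤ a * f t) : Antitone fun t => Real.exp (-a * t) * f t := by
  refine antitone_of_hasDerivAt_nonpos
    (fun t => (((hasDerivAt_id t).const_mul (-a)).exp).mul (hf t)) fun t => ?_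
  have := mul_le_mul_of_nonneg_left (hle t) (Real.exp_pos (-a * t)).le
  simp only [id, Pi.zero_apply]
  linarith

theorem nonpos_of_deriv_le_mul {f f' : ℝ → ℝ} {a ρ C : ℝ} (hf : ∀ t, HasDerivAt f (f' t) t)
    (hle : ∀ t, f' t ≤ a * f t) (haρ : a < ρ) (hC : ∀ t, f t ≤ C * Real.exp (ρ * t)) (t : ℝ) :
    f t ≤ 0 := by
  have hlim : Tendsto (fun s => C * Real.exp ((ρ - a) * s)) atBot (𝓝 (C * 0)) :=
    (Real.tendsto_exp_atBot.comp
      (tendsto_id.const_mul_atBot (sub_pos.2 haρ))).const_mul C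
  rw [mul_zero] at hlim
  have hanti := antitone_exp_mul_of_deriv_le hf hle
  refine nonpos_of_mul_nonpos_right (ge_of_tendsto hlim (eventually_atBot.2 ⟨t, fun s hs => ?_⟩))
    (Real.exp_pos (-a * t))
  calc Real.exp (-a * t) * f t ≤ Real.exp (-a * s) * f s := hanti hs
    _ ≤ Real.exp (-a * s) * (C * Real.exp (ρ * s)) :=
        mul_le_mul_of_nonneg_left (hC s) (Real.exp_pos _).le
    _ = C * Real.exp ((ρ - a) * s) := by
        rw [mul_left_comm, ← Real.exp_add]; ring_nf

variable {E : Type*} [NormedAddCommGroup E] [NormedSpace ℝ E]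

theorem setIntegral_Ioi_comp_sub (f : ℝ → E) (t a : ℝ) :
    ∫ s in Ioi t, f (s - a) = ∫ s in Ioi (t - a), f s := by
  rw [← integral_indicator measurableSet_Ioi, ← integral_indicator measurableSet_Ioi,
    ← integral_sub_right_eq_self ((Ioi (t - a)).indicator f) a]
  simp only [indicator_apply, mem_Ioi, sub_lt_sub_iff_right]

variable [CompleteSpace E]

theorem hasDerivAt_integral_Iic {f : ℝ → E} (hf : Continuous f)
    (hi : ∀ t, IntegrableOn f (Iic t)) (t : ℝ) :
    HasDerivAt (fun t => ∫ s in Iic t, f s) (f t) t := by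
  have hsplit : (fun t => ∫ s in Iic t, f s)
      = fun t => (∫ s in Iic 0, f s) + ∫ s in (0 : ℝ)..t, f s := by
    funext u
    rw [← intervalIntegral.integral_Iic_sub_Iic (hi 0) (hi u), add_sub_cancel]
  rw [hsplit]
  exact (hf.integral_hasStrictDerivAt 0 t).hasDerivAt.const_add _

theorem hasDerivAt_integral_Ioi {f : ℝ → E} (hf : Continuous f)
    (hi : ∀ t, IntegrableOn f (Ioi t)) (t : ℝ) :
    HasDerivAt (fun t => ∫ s in Ioi t, f s) (-f t) t := by
  have hsplit : (fun t => ∫ s in Ioi t, f s)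
      = fun t => (∫ s in Ioi 0, f s) - ∫ s in (0 : ℝ)..t, f s := by
    funext u
    rw [← intervalIntegral.integral_interval_add_Ioi (hi 0) (hi u), add_sub_cancel_left]
  rw [hsplit]
  exact (hf.integral_hasStrictDerivAt 0 t).hasDerivAt.const_sub _

end Calculus

section ExpBounded

/-- `f t = O(exp (μ t))`, uniformly in `t ∈ ℝ`. A bounded function with this property for some
`μ > 0` decays exponentially at `-∞`. -/
def ExpBounded (μ : ℝ) (f : ℝ → ℝ) : Prop :=
  f =O[⊤] fun t => Real.exp (μ * t)

namespace ExpBounded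

variable {μ μ₁ μ₂ ν x : ℝ} {f g : ℝ → ℝ}

theorem of_le {C : ℝ} (h : ∀ t, |f t| ≤ C * Real.exp (μ * t)) : ExpBounded μ f :=
  isBigO_top.2 ⟨C, fun t => by simpa using h t⟩

theorem exists_le (h : ExpBounded μ f) : ∃ C, 0 ≤ C ∧ ∀ t, |f t| ≤ C * Real.exp (μ * t) := by
  obtain ⟨C, hC, hle⟩ := h.exists_nonneg
  exact ⟨C, hC, fun t => by simpa using isBigOWith_top.1 hle t⟩

theorem of_abs_le {C : ℝ} (h : ∀ t, |f t| ≤ C) : ExpBounded 0 f :=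
  of_le (C := C) (by simpa using h)

theorem interpolate (h₁ : ExpBounded μ₁ f) (h₂ : ExpBounded μ₂ f) (hμ₁ : μ₁ ≤ μ) (hμ₂ : μ ≤ μ₂) :
    ExpBounded μ f := by
  obtain ⟨C₁, hC₁, h₁⟩ := h₁.exists_le
  obtain ⟨C₂, hC₂, h₂⟩ := h₂.exists_le
  refine of_le (C := max C₁ C₂) fun t => ?_
  rcases le_total 0 t with ht | ht
  · exact (h₁ t).trans (mul_le_mul (le_max_left _ _)
      (Real.exp_le_exp.2 (mul_le_mul_of_nonneg_right hμ₁ ht)) (Real.exp_pos _).le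
      (hC₁.trans (le_max_left _ _)))
  · exact (h₂ t).trans (mul_le_mul (le_max_right _ _)
      (Real.exp_le_exp.2 (mul_le_mul_of_nonpos_right hμ₂ ht)) (Real.exp_pos _).le
      (hC₂.trans (le_max_right _ _)))

theorem mul (hf : ExpBounded μ f) (hg : ExpBounded ν g) :
    ExpBounded (μ + ν) fun t => f t * g t := by
  simpa only [ExpBounded, add_mul, Real.exp_add] using IsBigO.mul hf hg

theorem exp_mul (hf : ExpBounded μ f) (ν : ℝ) :
    ExpBounded (ν + μ) fun t => Real.exp (ν * t) * f t :=
  mul (isBigO_refl _ _) hf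

theorem comp_sub_const (hf : ExpBounded μ f) (a : ℝ) : ExpBounded μ fun t => f (t - a) := by
  obtain ⟨C, -, hC⟩ := hf.exists_le
  refine of_le (C := C * Real.exp (-μ * a)) fun t => (hC (t - a)).trans_eq ?_
  rw [mul_assoc, ← Real.exp_add]
  ring_nf

theorem integrableOn_Ioi (hf : ExpBounded μ f) (hcont : Continuous f) (hx : μ < x) (t : ℝ) :
    IntegrableOn (fun s => Real.exp (-x * s) * f s) (Ioi t) :=
  IsBigO.integrable (by fun_prop) (hf.exp_mul (-x)) (integrableOn_exp_mul_Ioi (by linarith) t)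

theorem integrableOn_Iic (hf : ExpBounded μ f) (hcont : Continuous f) (hx : x < μ) (t : ℝ) :
    IntegrableOn (fun s => Real.exp (-x * s) * f s) (Iic t) :=
  IsBigO.integrable (by fun_prop) (hf.exp_mul (-x)) (integrableOn_exp_mul_Iic (by linarith) t)

theorem integrableOn_Iic_of_pos (hf : ExpBounded μ f) (hcont : Continuous f) (hμ : 0 < μ) (t : ℝ) :
    IntegrableOn f (Iic t) := by
  simpa using hf.integrableOn_Iic hcont hμ t

theorem integral_Iic (hf : ExpBounded μ f) (hμ : 0 < μ) :
    ExpBounded μ fun t => ∫ s in Iic t, f s := by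
  obtain ⟨C, -, hC⟩ := hf.exists_le
  refine of_le (C := C / μ) fun t => ?_
  calc |∫ s in Iic t, f s| ≤ ∫ s in Iic t, C * Real.exp (μ * s) :=
        (Real.norm_eq_abs _).symm.trans_le <| norm_integral_le_of_norm_le
          ((integrableOn_exp_mul_Iic hμ t).const_mul C) (Eventually.of_forall hC)
    _ = C / μ * Real.exp (μ * t) := by
        rw [integral_const_mul, integral_exp_mul_Iic hμ]; ring

theorem integral_Ioi (hf : ExpBounded μ f) (hμ : μ < 0) :
    ExpBounded μ fun t => ∫ s in Ioi t, f s := by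
  obtain ⟨C, -, hC⟩ := hf.exists_le
  refine of_le (C := C / -μ) fun t => ?_
  calc |∫ s in Ioi t, f s| ≤ ∫ s in Ioi t, C * Real.exp (μ * s) :=
        (Real.norm_eq_abs _).symm.trans_le <| norm_integral_le_of_norm_le
          ((integrableOn_exp_mul_Ioi hμ t).const_mul C) (Eventually.of_forall hC)
    _ = C / -μ * Real.exp (μ * t) := by
        rw [integral_const_mul, integral_exp_mul_Ioi hμ]; ring

theorem isLittleO_atBot (hf : ExpBounded μ f) (hν : ν < μ) :
    f =o[atBot] fun t => Real.exp (ν * t) := by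
  refine (hf.mono le_top).trans_isLittleO (Real.isLittleO_exp_comp_exp_comp.2 ?_)
  simpa only [← sub_mul, id] using tendsto_id.const_mul_atBot_of_neg (sub_neg.2 hν)

theorem of_sub_mul_exp {l B : ℝ} (hf : ExpBounded 0 f) (hl : 0 ≤ l) (hx : l ≤ x)
    (h : ExpBounded x fun t => f t - B * Real.exp (l * t)) : ExpBounded l f := by
  obtain ⟨C₀, hC₀, hle₀⟩ := hf.exists_le
  obtain ⟨C, hC, hle⟩ := h.exists_le
  refine of_le (C := C₀ + (C + |B|)) fun t => ?_
  have hB := mul_nonneg (abs_nonneg B) (Real.exp_pos (l * t)).le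
  rcases le_total 0 t with ht | ht
  · have he : C₀ * Real.exp (0 * t) ≤ C₀ * Real.exp (l * t) :=
      mul_le_mul_of_nonneg_left (Real.exp_le_exp.2 (mul_le_mul_of_nonneg_right hl ht)) hC₀
    linarith [hle₀ t, mul_nonneg hC (Real.exp_pos (l * t)).le]
  · have he : C * Real.exp (x * t) ≤ C * Real.exp (l * t) :=
      mul_le_mul_of_nonneg_left (Real.exp_le_exp.2 (mul_le_mul_of_nonpos_right hx ht)) hC
    have habs : |f t| ≤ |f t - B * Real.exp (l * t)| + |B * Real.exp (l * t)| := by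
      simpa using abs_add_le (f t - B * Real.exp (l * t)) (B * Real.exp (l * t))
    rw [abs_mul, Real.abs_exp] at habs
    linarith [hle t, mul_nonneg hC₀ (Real.exp_pos (l * t)).le]

end ExpBounded

/-- Continuous functions that are both `O(exp (μ₁ t))` and `O(exp (μ₂ t))`. Their bilateral Laplace
transform converges absolutely in the strip `μ₁ < Re z < μ₂`. -/
structure StripBounded (μ₁ μ₂ : ℝ) (f : ℝ → ℝ) : Prop where
  continuous : Continuous f
  left : ExpBounded μ₁ f
  right : ExpBounded μ₂ f

namespace StripBounded

variable {μ₁ μ₂ ν₁ ν₂ x : ℝ} {f g : ℝ → ℝ}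

theorem add (hf : StripBounded μ₁ μ₂ f) (hg : StripBounded μ₁ μ₂ g) :
    StripBounded μ₁ μ₂ fun t => f t + g t :=
  ⟨hf.continuous.add hg.continuous, IsBigO.add hf.left hg.left, IsBigO.add hf.right hg.right⟩

theorem const_mul (hf : StripBounded μ₁ μ₂ f) (k : ℝ) : StripBounded μ₁ μ₂ fun t => k * f t :=
  ⟨hf.continuous.const_mul k, IsBigO.const_mul_left hf.left k, IsBigO.const_mul_left hf.right k⟩

theorem sub (hf : StripBounded μ₁ μ₂ f) (hg : StripBounded μ₁ μ₂ g) :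
    StripBounded μ₁ μ₂ fun t => f t - g t :=
  ⟨hf.continuous.sub hg.continuous, IsBigO.sub hf.left hg.left, IsBigO.sub hf.right hg.right⟩

theorem mul (hf : StripBounded μ₁ μ₂ f) (hg : StripBounded ν₁ ν₂ g) :
    StripBounded (μ₁ + ν₁) (μ₂ + ν₂) fun t => f t * g t :=
  ⟨hf.continuous.mul hg.continuous, hf.left.mul hg.left, hf.right.mul hg.right⟩

theorem comp_sub_const (hf : StripBounded μ₁ μ₂ f) (a : ℝ) :
    StripBounded μ₁ μ₂ fun t => f (t - a) :=
  ⟨hf.continuous.comp (continuous_sub_right a), hf.left.comp_sub_const a,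
    hf.right.comp_sub_const a⟩

theorem mono (hf : StripBounded μ₁ μ₂ f) (h₁ : μ₁ ≤ ν₁) (hν : ν₁ ≤ ν₂) (h₂ : ν₂ ≤ μ₂) :
    StripBounded ν₁ ν₂ f :=
  ⟨hf.continuous, hf.left.interpolate hf.right h₁ (hν.trans h₂),
    hf.left.interpolate hf.right (h₁.trans hν) h₂⟩

theorem integrable (hf : StripBounded μ₁ μ₂ f) (hx : x ∈ Ioo μ₁ μ₂) :
    Integrable fun s => Real.exp (-x * s) * f s := by
  rw [← integrableOn_univ, ← Iic_union_Ioi (a := (0 : ℝ))]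
  exact (hf.right.integrableOn_Iic hf.continuous hx.2 0).union
    (hf.left.integrableOn_Ioi hf.continuous hx.1 0)

end StripBounded

end ExpBounded

section Laplace

/-- The bilateral Laplace transform `∫ exp (-z t) f t dt`. -/
noncomputable def laplace (f : ℝ → ℝ) (z : ℂ) : ℂ :=
  ∫ t : ℝ, Complex.exp (-z * t) * f t

theorem integrable_cexp_mul {f : ℝ → ℝ} {z : ℂ}
    (hf : Integrable fun t => Real.exp (-z.re * t) * f t) :
    Integrable fun t : ℝ => Complex.exp (-z * t) * f t := by
  have hmul := (hf.ofReal (𝕜 := ℂ)).bdd_mul (c := 1)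
    (f := fun t : ℝ => Complex.exp ((-(z.im * t) : ℝ) * Complex.I))
    (by fun_prop) (Eventually.of_forall fun t => by rw [Complex.norm_exp_ofReal_mul_I])
  refine hmul.congr (Eventually.of_forall fun t => ?_)
  simp only [RCLike.ofReal_mul, Complex.coe_algebraMap]
  rw [← mul_assoc, Complex.ofReal_exp, ← Complex.exp_add]
  congr 2
  push_cast
  linear_combination (-(t : ℂ)) * (Complex.re_add_im z)

theorem laplace_ofReal (f : ℝ → ℝ) (x : ℝ) :
    laplace f x = ((∫ t, Real.exp (-x * t) * f t : ℝ) : ℂ) := by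
  rw [← integral_complex_ofReal]
  push_cast
  rfl

theorem norm_laplace_le (f : ℝ → ℝ) (z : ℂ) :
    ‖laplace f z‖ ≤ ∫ t, Real.exp (-z.re * t) * |f t| := by
  refine (norm_integral_le_integral_norm _).trans_eq (integral_congr_ae
    (Eventually.of_forall fun t => ?_))
  simp [Complex.norm_exp]

theorem laplace_comp_sub_const (f : ℝ → ℝ) (a : ℝ) (z : ℂ) :
    laplace (fun t => f (t - a)) z = Complex.exp (-z * a) * laplace f z := by
  unfold laplace
  rw [← integral_sub_right_eq_self (fun t : ℝ => Complex.exp (-z * t) * (f t : ℂ)) a,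
    ← integral_const_mul]
  refine integral_congr_ae (Eventually.of_forall fun t => ?_)
  simp only
  rw [← mul_assoc, ← Complex.exp_add]
  push_cast
  ring_nf

theorem laplace_const_mul (k : ℝ) (f : ℝ → ℝ) (z : ℂ) :
    laplace (fun t => k * f t) z = k * laplace f z := by
  unfold laplace
  rw [← integral_const_mul]
  refine integral_congr_ae (Eventually.of_forall fun t => ?_)
  simp only [Complex.ofReal_mul]
  ring

theorem laplace_add {f g : ℝ → ℝ} {z : ℂ} (hf : Integrable fun t => Real.exp (-z.re * t) * f t)
    (hg : Integrable fun t => Real.exp (-z.re * t) * g t) :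
    laplace (fun t => f t + g t) z = laplace f z + laplace g z := by
  unfold laplace
  simp only [Complex.ofReal_add, mul_add]
  exact integral_add (integrable_cexp_mul hf) (integrable_cexp_mul hg)

theorem laplace_sub {f g : ℝ → ℝ} {z : ℂ} (hf : Integrable fun t => Real.exp (-z.re * t) * f t)
    (hg : Integrable fun t => Real.exp (-z.re * t) * g t) :
    laplace (fun t => f t - g t) z = laplace f z - laplace g z := by
  unfold laplace
  simp only [Complex.ofReal_sub, mul_sub]
  exact integral_sub (integrable_cexp_mul hf) (integrable_cexp_mul hg)

theorem laplace_deriv {f f' : ℝ → ℝ} (hd : ∀ t, HasDerivAt f (f' t) t) {z : ℂ}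
    (hf : Integrable fun t => Real.exp (-z.re * t) * f t)
    (hf' : Integrable fun t => Real.exp (-z.re * t) * f' t) :
    laplace f' z = z * laplace f z := by
  have hprod : ∀ t : ℝ, HasDerivAt (fun t : ℝ => Complex.exp (-z * t) * f t)
      (Complex.exp (-z * t) * f' t - z * (Complex.exp (-z * t) * f t)) t := by
    intro t
    refine ((((Complex.ofRealCLM.hasDerivAt (x := t)).const_mul (-z)).cexp).mul
      (hd t).ofReal_comp).congr_deriv ?_
    simp only [Complex.ofRealCLM_apply, Complex.ofReal_one]
    ring
  have i := integrable_cexp_mul hf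
  have i' := integrable_cexp_mul hf'
  have hzero := integral_eq_zero_of_hasDerivAt_of_integrable hprod (i'.sub (i.const_mul z)) i
  rwa [integral_sub i' (i.const_mul z), integral_const_mul, sub_eq_zero] at hzero

theorem laplace_eq_mellin (f : ℝ → ℝ) (z : ℂ) :
    laplace f z = mellin (fun u => (f (-Real.log u) : ℂ)) z := by
  rw [mellin_eq_fourier, Real.fourier_real_eq_integral_exp_smul]
  refine integral_congr_ae (Eventually.of_forall fun t => ?_)
  have hexp : Complex.exp (-z * t)
      = Complex.exp ((-2 * Real.pi * t * (z.im / (2 * Real.pi)) : ℝ) * Complex.I)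
        * (Real.exp (-z.re * t) : ℝ) := by
    have hπ : -2 * Real.pi * t * (z.im / (2 * Real.pi)) = -(z.im * t) := by
      field_simp
    rw [hπ, Complex.ofReal_exp, ← Complex.exp_add]
    congr 1
    push_cast
    linear_combination (t : ℂ) * (Complex.re_add_im z)
  simp only [Real.log_exp, neg_neg, smul_eq_mul, Complex.real_smul]
  rw [hexp, mul_assoc]

namespace ExpBounded

variable {μ : ℝ} {f : ℝ → ℝ}

theorem exists_norm_comp_neg_log_le (hf : ExpBounded μ f) :
    ∃ C, ∀ u > 0, ‖(f (-Real.log u) : ℂ)‖ ≤ C * ‖u ^ (-μ)‖ := by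
  obtain ⟨C, -, hC⟩ := hf.exists_le
  refine ⟨C, fun u hu => ?_⟩
  rw [Complex.norm_real, Real.norm_eq_abs, Real.norm_eq_abs, Real.rpow_def_of_pos hu, Real.abs_exp,
    mul_neg, ← neg_mul, mul_comm _ μ]
  exact hC _

theorem isBigO_comp_neg_log_atTop (hf : ExpBounded μ f) :
    (fun u => (f (-Real.log u) : ℂ)) =O[atTop] fun u => u ^ (-μ) := by
  obtain ⟨C, hC⟩ := hf.exists_norm_comp_neg_log_le
  exact IsBigO.of_bound C ((eventually_gt_atTop 0).mono hC)

theorem isBigO_comp_neg_log_nhdsGT (hf : ExpBounded μ f) :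
    (fun u => (f (-Real.log u) : ℂ)) =O[𝓝[>] 0] fun u => u ^ (-μ) := by
  obtain ⟨C, hC⟩ := hf.exists_norm_comp_neg_log_le
  exact IsBigO.of_bound C (eventually_mem_nhdsWithin.mono hC)

end ExpBounded

namespace StripBounded

variable {μ₁ μ₂ : ℝ} {f : ℝ → ℝ}

theorem locallyIntegrableOn_comp_neg_log (hf : StripBounded μ₁ μ₂ f) :
    LocallyIntegrableOn (fun u => (f (-Real.log u) : ℂ)) (Ioi 0) := by
  refine ContinuousOn.locallyIntegrableOn (fun u hu => ContinuousAt.continuousWithinAt ?_)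
    measurableSet_Ioi
  have hlog := Real.continuousAt_log (ne_of_gt hu)
  have := hf.continuous
  fun_prop

theorem differentiableOn_laplace (hf : StripBounded μ₁ μ₂ f) :
    DifferentiableOn ℂ (laplace f) (Complex.re ⁻¹' Ioo μ₁ μ₂) := fun z hz => by
  rw [funext (laplace_eq_mellin f)]
  exact (mellin_differentiableAt_of_isBigO_rpow hf.locallyIntegrableOn_comp_neg_log
    hf.right.isBigO_comp_neg_log_atTop hz.2 hf.left.isBigO_comp_neg_log_nhdsGT
    hz.1).differentiableWithinAt

theorem laplace_inversion (hf : StripBounded μ₁ μ₂ f) {x : ℝ} (hx : x ∈ Ioo μ₁ μ₂)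
    (hL : Complex.VerticalIntegrable (laplace f) x) (t : ℝ) :
    (f t : ℂ) = (2 * Real.pi : ℝ)⁻¹ *
      ∫ y : ℝ, Complex.exp ((x + y * Complex.I) * t) * laplace f (x + y * Complex.I) := by
  have hmellin : laplace f = mellin fun u => (f (-Real.log u) : ℂ) :=
    funext (laplace_eq_mellin f)
  have hcont : ContinuousAt (fun u => (f (-Real.log u) : ℂ)) (Real.exp (-t)) := by
    have hlog := Real.continuousAt_log (Real.exp_pos (-t)).ne'
    have := hf.continuous
    fun_prop
  have hinv := mellinInv_mellin_eq x _ (Real.exp_pos (-t))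
    (mellinConvergent_of_isBigO_rpow hf.locallyIntegrableOn_comp_neg_log
      hf.right.isBigO_comp_neg_log_atTop hx.2 hf.left.isBigO_comp_neg_log_nhdsGT hx.1)
    (hmellin ▸ hL) hcont
  have hpow : ∀ z : ℂ, (Real.exp (-t) : ℂ) ^ (-z) = Complex.exp (z * t) := fun z => by
    rw [Complex.cpow_def_of_ne_zero (by simp), ← Complex.ofReal_log (Real.exp_pos _).le,
      Real.log_exp]
    push_cast
    ring_nf
  rw [← hmellin, Real.log_exp, neg_neg, mellinInv] at hinv
  simp only [hpow, smul_eq_mul, one_div, Complex.real_smul] at hinv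
  exact hinv.symm

theorem norm_laplace_le (hf : StripBounded μ₁ μ₂ f) : ∃ C₁ C₂ : ℝ, 0 ≤ C₁ ∧ 0 ≤ C₂ ∧
    ∀ z : ℂ, z.re ∈ Ioo μ₁ μ₂ →
      ‖laplace f z‖ ≤ C₁ / (z.re - μ₁) + C₂ / (μ₂ - z.re) := by
  obtain ⟨C₁, hC₁, h₁⟩ := hf.left.exists_le
  obtain ⟨C₂, hC₂, h₂⟩ := hf.right.exists_le
  refine ⟨C₁, C₂, hC₁, hC₂, fun z hz => (_root_.norm_laplace_le f z).trans ?_⟩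
  set x := z.re
  have hl : 0 < μ₂ - x := sub_pos.2 hz.2
  have hr : μ₁ - x < 0 := sub_neg.2 hz.1
  have i : Integrable fun t => Real.exp (-x * t) * |f t| := by
    simpa [abs_mul] using (hf.integrable hz).abs
  have hle : ∀ {C μ : ℝ}, (∀ t, |f t| ≤ C * Real.exp (μ * t)) → ∀ t,
      Real.exp (-x * t) * |f t| ≤ C * Real.exp ((μ - x) * t) := fun h t => by
    calc _ ≤ _ := mul_le_mul_of_nonneg_left (h t) (Real.exp_pos (-x * t)).le
      _ = _ := by rw [mul_left_comm, ← Real.exp_add]; ring_nf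
  calc ∫ t, Real.exp (-x * t) * |f t|
      = (∫ t in Iic 0, Real.exp (-x * t) * |f t|) + ∫ t in Ioi 0, Real.exp (-x * t) * |f t| :=
        (intervalIntegral.integral_Iic_add_Ioi i.integrableOn i.integrableOn).symm
    _ ≤ (∫ t in Iic 0, C₂ * Real.exp ((μ₂ - x) * t)) + ∫ t in Ioi 0, C₁ * Real.exp ((μ₁ - x) * t) :=
        add_le_add
          (integral_mono i.integrableOn ((integrableOn_exp_mul_Iic hl 0).const_mul C₂) (hle h₂))
          (integral_mono i.integrableOn ((integrableOn_exp_mul_Ioi hr 0).const_mul C₁) (hle h₁))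
    _ = C₁ / (x - μ₁) + C₂ / (μ₂ - x) := by
        rw [integral_const_mul, integral_const_mul, integral_exp_mul_Iic hl,
          integral_exp_mul_Ioi hr, ← neg_sub x μ₁, neg_div_neg_eq]
        simp only [mul_zero, Real.exp_zero]
        ring

theorem laplace_isBigO_left (hf : StripBounded μ₁ μ₂ f) (hμ : μ₁ < μ₂) :
    (fun x : ℝ => laplace f x) =O[𝓝[<] μ₂] fun x => (x - μ₂)⁻¹ := by
  obtain ⟨C₁, C₂, hC₁, -, hle⟩ := hf.norm_laplace_le
  refine IsBigO.of_bound (C₁ + C₂) ?_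
  filter_upwards [Ioo_mem_nhdsLT (add_div_two_lt_right.2 hμ)] with x hx
  have hmid : μ₂ - x ≤ x - μ₁ := by linarith [hx.1]
  have hx₂ : 0 < μ₂ - x := sub_pos.2 hx.2
  have hz : (x : ℂ).re ∈ Ioo μ₁ μ₂ := ⟨sub_pos.1 (hx₂.trans_le hmid), hx.2⟩
  rw [norm_inv, Real.norm_eq_abs, abs_sub_comm, abs_of_pos hx₂, ← div_eq_mul_inv, add_div]
  exact (hle x hz).trans (add_le_add_left (div_le_div_of_nonneg_left hC₁ hx₂ hmid) _)

end StripBounded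

end Laplace

section ContourShift

variable {G : ℂ → ℂ} {x₀ x₁ C : ℝ}

theorem verticalIntegrable_of_norm_le (hG : DifferentiableOn ℂ G (Complex.re ⁻¹' Icc x₀ x₁))
    (hC : ∀ z : ℂ, z.re ∈ Icc x₀ x₁ → ‖G z‖ ≤ C * (1 + z.im ^ 2)⁻¹) {x : ℝ}
    (hx : x ∈ Icc x₀ x₁) : Complex.VerticalIntegrable G x := by
  have hcont : Continuous fun y : ℝ => G (x + y * Complex.I) :=
    continuousOn_univ.1 (hG.continuousOn.comp (by fun_prop) fun y _ => by simpa using hx)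
  exact (integrable_inv_one_add_sq.const_mul C).mono' hcont.aestronglyMeasurable
    (Eventually.of_forall fun y => by simpa using hC (x + y * Complex.I) (by simpa using hx))

theorem tendsto_integral_horizontal (h01 : x₀ ≤ x₁)
    (hC : ∀ z : ℂ, z.re ∈ Icc x₀ x₁ → ‖G z‖ ≤ C * (1 + z.im ^ 2)⁻¹) :
    Tendsto (fun y : ℝ => ∫ x in x₀..x₁, G (x + y * Complex.I)) (cocompact ℝ) (𝓝 0) := by
  have hsq : Tendsto (fun y : ℝ => 1 + y ^ 2) (cocompact ℝ) atTop := by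
    simpa using tendsto_atTop_add_const_left _ (1 : ℝ)
      ((tendsto_pow_atTop two_ne_zero).comp (tendsto_norm_cocompact_atTop (E := ℝ)))
  have hbound : Tendsto (fun y : ℝ => C * (1 + y ^ 2)⁻¹ * |x₁ - x₀|) (cocompact ℝ) (𝓝 0) := by
    simpa using (hsq.inv_tendsto_atTop.const_mul C).mul_const |x₁ - x₀|
  refine squeeze_zero_norm (fun y => ?_) hbound
  refine intervalIntegral.norm_integral_le_of_norm_le_const fun x hx => ?_
  rw [uIoc_of_le h01] at hx
  simpa using hC (x + y * Complex.I) (by simpa using ⟨hx.1.le, hx.2⟩)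

theorem integral_vertical_eq (h01 : x₀ ≤ x₁)
    (hG : DifferentiableOn ℂ G (Complex.re ⁻¹' Icc x₀ x₁))
    (hC : ∀ z : ℂ, z.re ∈ Icc x₀ x₁ → ‖G z‖ ≤ C * (1 + z.im ^ 2)⁻¹) :
    ∫ y : ℝ, G (x₀ + y * Complex.I) = ∫ y : ℝ, G (x₁ + y * Complex.I) := by
  have hvert : ∀ x ∈ Icc x₀ x₁, Tendsto (fun T : ℝ => ∫ y in (-T)..T, G (x + y * Complex.I)) atTop
      (𝓝 (∫ y : ℝ, G (x + y * Complex.I))) := fun x hx =>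
    intervalIntegral_tendsto_integral (verticalIntegrable_of_norm_le hG hC hx)
      tendsto_neg_atTop_atBot tendsto_id
  have hhor := tendsto_integral_horizontal h01 hC
  have hbot := hhor.comp (tendsto_neg_atTop_atBot.mono_right atBot_le_cocompact)
  have htop := hhor.comp (tendsto_id.mono_right atTop_le_cocompact)
  have hrect : ∀ T : ℝ, (∫ x in x₀..x₁, G (x + (-T : ℝ) * Complex.I))
      - (∫ x in x₀..x₁, G (x + T * Complex.I))
      + Complex.I * (∫ y in (-T)..T, G (x₁ + y * Complex.I))
      - Complex.I * (∫ y in (-T)..T, G (x₀ + y * Complex.I)) = 0 := fun T => by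
    simpa using Complex.integral_boundary_rect_eq_zero_of_differentiableOn G
      (x₀ + (-T : ℝ) * Complex.I) (x₁ + T * Complex.I) (hG.mono fun z hz => by
        simpa [uIcc_of_le h01] using (Complex.mem_reProdIm.1 hz).1)
  have hlim := ((hbot.sub htop).add ((hvert x₁ ⟨h01, le_rfl⟩).const_mul Complex.I)).sub
    ((hvert x₀ ⟨le_rfl, h01⟩).const_mul Complex.I)
  have hzero := tendsto_nhds_unique (hlim.congr hrect) tendsto_const_nhds
  refine mul_left_cancel₀ Complex.I_ne_zero ?_
  linear_combination -hzero

theorem norm_cexp_mul_mul (t : ℝ) (z w : ℂ) :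
    ‖Complex.exp (z * t) * w‖ = Real.exp (z.re * t) * ‖w‖ := by
  simp [Complex.norm_exp]

theorem integral_vertical_cexp_mul_eq (h01 : x₀ ≤ x₁)
    (hG : DifferentiableOn ℂ G (Complex.re ⁻¹' Icc x₀ x₁))
    (hC : ∀ z : ℂ, z.re ∈ Icc x₀ x₁ → ‖G z‖ ≤ C * (1 + z.im ^ 2)⁻¹) (t : ℝ) :
    ∫ y : ℝ, Complex.exp ((x₀ + y * Complex.I) * t) * G (x₀ + y * Complex.I)
      = ∫ y : ℝ, Complex.exp ((x₁ + y * Complex.I) * t) * G (x₁ + y * Complex.I) := by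
  refine integral_vertical_eq (G := fun z => Complex.exp (z * t) * G z)
    (C := Real.exp (max (x₀ * t) (x₁ * t)) * C) h01 (DifferentiableOn.mul (by fun_prop) hG)
    fun z hz => ?_
  rw [norm_cexp_mul_mul, mul_assoc]
  refine mul_le_mul (Real.exp_le_exp.2 ?_) (hC z hz) (norm_nonneg _) (Real.exp_pos _).le
  rcases le_total 0 t with ht | ht
  · exact le_max_of_le_right (mul_le_mul_of_nonneg_right hz.2 ht)
  · exact le_max_of_le_left (mul_le_mul_of_nonpos_right hz.1 ht)

theorem norm_integral_vertical_cexp_mul_le (G : ℂ → ℂ) (x t : ℝ) :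
    ‖∫ y : ℝ, Complex.exp ((x + y * Complex.I) * t) * G (x + y * Complex.I)‖
      ≤ (∫ y : ℝ, ‖G (x + y * Complex.I)‖) * Real.exp (x * t) := by
  refine (norm_integral_le_integral_norm _).trans_eq ?_
  rw [← integral_mul_const]
  refine integral_congr_ae (Eventually.of_forall fun y => ?_)
  simp only
  rw [norm_cexp_mul_mul, mul_comm]
  simp

theorem StripBounded.expBounded_of_laplace_continuation {μ₁ μ₂ : ℝ} {f : ℝ → ℝ}
    (hf : StripBounded μ₁ μ₂ f) (hx₀ : x₀ ∈ Ioo μ₁ μ₂) (h01 : x₀ ≤ x₁)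
    (hG : DifferentiableOn ℂ G (Complex.re ⁻¹' Icc x₀ x₁))
    (hC : ∀ z : ℂ, z.re ∈ Icc x₀ x₁ → ‖G z‖ ≤ C * (1 + z.im ^ 2)⁻¹)
    (hL : ∀ y : ℝ, laplace f (x₀ + y * Complex.I) = G (x₀ + y * Complex.I)) :
    ExpBounded x₁ f := by
  have hvert : Complex.VerticalIntegrable (laplace f) x₀ := by
    simpa only [Complex.VerticalIntegrable, hL] using
      verticalIntegrable_of_norm_le hG hC ⟨le_rfl, h01⟩
  refine ExpBounded.of_le
    (C := (2 * Real.pi)⁻¹ * ∫ y : ℝ, ‖G (x₁ + y * Complex.I)‖) fun t => ?_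
  have hinv := hf.laplace_inversion hx₀ hvert t
  simp only [hL] at hinv
  rw [integral_vertical_cexp_mul_eq h01 hG hC] at hinv
  rw [← Real.norm_eq_abs, ← Complex.norm_real, hinv, norm_mul, Complex.norm_real,
    Real.norm_of_nonneg (by positivity), mul_assoc]
  exact mul_le_mul_of_nonneg_left (norm_integral_vertical_cexp_mul_le G x₁ t) (by positivity)

end ContourShift

section ConvexZeros

variable {f : ℝ → ℝ} {l₂ l₁ : ℝ}

/-- The sign pattern on `[0, ∞)` of a strictly convex function with positive zeros `l₂ ≤ l₁`, which
coincide if the zero is double. -/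
structure IsPositiveZeroPair (f : ℝ → ℝ) (l₂ l₁ : ℝ) : Prop where
  pos : 0 < l₂
  le : l₂ ≤ l₁
  eq_zero_left : f l₂ = 0
  eq_zero_right : f l₁ = 0
  pos_of_lt : ∀ x, 0 ≤ x → x < l₂ → 0 < f x
  neg_of_mem : ∀ x ∈ Ioo l₂ l₁, f x < 0
  pos_of_gt : ∀ x, l₁ < x → 0 < f x

theorem exists_isPositiveZeroPair {c : ℝ} (hconv : StrictConvexOn ℝ (Ici 0) f)
    (hcont : ContinuousOn f (Ici 0)) (h0 : 0 < f 0) (hc : 0 < f c)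
    (hex : ∃ x ∈ Icc 0 c, f x ≤ 0) : ∃ l₂ l₁, IsPositiveZeroPair f l₂ l₁ := by
  have hcpt : IsCompact (Icc 0 c ∩ f ⁻¹' Iic 0) :=
    isCompact_Icc.of_isClosed_subset ((hcont.mono Icc_subset_Ici_self).preimage_isClosed_of_isClosed
      isClosed_Icc isClosed_Iic) inter_subset_left
  have hmax : ∀ x y z, 0 ≤ x → x < y → y < z → f y < max (f x) (f z) := fun x y z hx hxy hyz =>
    hconv.lt_on_openSegment hx (hx.trans (hxy.trans hyz).le) (hxy.trans hyz).ne
      (openSegment_eq_Ioo (hxy.trans hyz) ▸ ⟨hxy, hyz⟩)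
  obtain ⟨l₂, ⟨hl₂, hfl₂⟩, hleast⟩ := hcpt.exists_isLeast hex
  obtain ⟨l₁, ⟨hl₁, hfl₁⟩, hgreatest⟩ := hcpt.exists_isGreatest hex
  have hz₂ : f l₂ = 0 := by
    obtain ⟨z, hz, hfz⟩ := intermediate_value_Icc' hl₂.1
      (hcont.mono Icc_subset_Ici_self) ⟨hfl₂, h0.le⟩
    rwa [hz.2.antisymm (hleast ⟨⟨hz.1, hz.2.trans hl₂.2⟩, hfz.le⟩)] at hfz
  have hz₁ : f l₁ = 0 := by
    obtain ⟨z, hz, hfz⟩ := intermediate_value_Icc hl₁.2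
      (hcont.mono (Icc_subset_Ici_self.trans (Ici_subset_Ici.2 hl₁.1))) ⟨hfl₁, hc.le⟩
    rwa [hz.1.antisymm' (hgreatest ⟨⟨hl₁.1.trans hz.1, hz.2⟩, hfz.le⟩)] at hfz
  refine ⟨l₂, l₁, hl₂.1.lt_of_ne ?_, hleast ⟨hl₁, hfl₁⟩, hz₂, hz₁, ?_, ?_, ?_⟩
  · rintro rfl
    exact h0.ne' hz₂
  · intro x hx hxl
    by_contra! hfx
    exact hxl.not_ge (hleast ⟨⟨hx, hxl.le.trans hl₂.2⟩, hfx⟩)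
  · intro x hx
    simpa only [hz₂, hz₁, max_self] using hmax l₂ x l₁ hl₂.1 hx.1 hx.2
  · intro x hx
    rcases le_or_gt x c with hxc | hxc
    · by_contra! hfx
      exact hx.not_ge (hgreatest ⟨⟨hl₁.1.trans hx.le, hxc⟩, hfx⟩)
    · have hlc : l₁ < c := hl₁.2.lt_of_ne (by rintro rfl; exact hc.ne' hz₁)
      have := hmax l₁ c x hl₁.1 hlc hxc
      rw [hz₁] at this
      exact (lt_max_iff.1 (hc.trans this)).resolve_left (lt_irrefl 0)

namespace IsPositiveZeroPair

theorem pos_right (hl : IsPositiveZeroPair f l₂ l₁) : 0 < l₁ :=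
  hl.pos.trans_le hl.le

theorem eq_or_eq (hl : IsPositiveZeroPair f l₂ l₁) {x : ℝ} (hx : 0 < x) (hfx : f x = 0) :
    x = l₂ ∨ x = l₁ := by
  by_contra! hne
  rcases hne.1.lt_or_gt with h | h
  · exact (hl.pos_of_lt x hx.le h).ne' hfx
  rcases hne.2.lt_or_gt with h' | h'
  · exact (hl.neg_of_mem x ⟨h, h'⟩).ne hfx
  · exact (hl.pos_of_gt x h').ne' hfx

theorem deriv_eq_zero (hl : IsPositiveZeroPair f l₂ l₁) (heq : l₂ = l₁) : deriv f l₂ = 0 := by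
  subst heq
  refine IsLocalMin.deriv_eq_zero ?_
  filter_upwards [lt_mem_nhds hl.pos] with x hx
  rw [hl.eq_zero_left]
  rcases lt_trichotomy x l₂ with h | rfl | h
  · exact (hl.pos_of_lt x hx.le h).le
  · exact hl.eq_zero_left.ge
  · exact (hl.pos_of_gt x h).le

theorem deriv_left_neg (hl : IsPositiveZeroPair f l₂ l₁) (hconv : StrictConvexOn ℝ (Ici 0) f)
    (hd : DifferentiableAt ℝ f l₂) (hlt : l₂ < l₁) : deriv f l₂ < 0 := by
  simpa [slope_def_field, hl.eq_zero_left, hl.eq_zero_right] using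
    hconv.lt_slope_of_hasDerivAt hl.pos.le hl.pos_right.le hlt hd.hasDerivAt

theorem deriv_right_pos (hl : IsPositiveZeroPair f l₂ l₁) (hconv : StrictConvexOn ℝ (Ici 0) f)
    (hd : DifferentiableAt ℝ f l₁) (hlt : l₂ < l₁) : 0 < deriv f l₁ := by
  simpa [slope_def_field, hl.eq_zero_left, hl.eq_zero_right] using
    hconv.slope_lt_of_hasDerivAt hl.pos.le hl.pos_right.le hlt hd.hasDerivAt

end IsPositiveZeroPair

end ConvexZeros

section Characteristic

variable {b c h : ℝ}

/-- The characteristic function `chi0`, with the delay `h = c τ` as a parameter. -/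
noncomputable def chi (b c h : ℝ) (z : ℂ) : ℂ :=
  z ^ 2 - c * z + (1 - b * Complex.exp (-z * h))⁻¹

theorem chi0_eq_chi (b c τ : ℝ) : chi0 b c τ = chi b c (c * τ) := by
  funext z
  simp only [chi0, chi, one_div, Complex.ofReal_mul, mul_assoc]

/-- The restriction of `chi` to the real axis. -/
noncomputable def chiReal (b c h x : ℝ) : ℝ :=
  x ^ 2 - c * x + (1 - b * Real.exp (-x * h))⁻¹

theorem chi_ofReal (x : ℝ) : chi b c h x = (chiReal b c h x : ℝ) := by
  simp [chi, chiReal]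

theorem mul_exp_neg_mul_le (hb0 : 0 ≤ b) (hh : 0 ≤ h) {x : ℝ} (hx : 0 ≤ x) :
    b * Real.exp (-x * h) ≤ b :=
  mul_le_of_le_one_right hb0
    (Real.exp_le_one_iff.2 (mul_nonpos_of_nonpos_of_nonneg (neg_nonpos.2 hx) hh))

theorem one_sub_mul_exp_pos (hb0 : 0 ≤ b) (hb1 : b < 1) (hh : 0 ≤ h) {x : ℝ} (hx : 0 ≤ x) :
    0 < 1 - b * Real.exp (-x * h) :=
  sub_pos.2 ((mul_exp_neg_mul_le hb0 hh hx).trans_lt hb1)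

theorem hasDerivAt_mul_exp_neg_mul (b h x : ℝ) :
    HasDerivAt (fun x => b * Real.exp (-x * h)) (-h * (b * Real.exp (-x * h))) x :=
  (((hasDerivAt_neg x).mul_const h).exp.const_mul b).congr_deriv (by ring)

theorem hasDerivAt_chiReal (hb0 : 0 ≤ b) (hb1 : b < 1) (hh : 0 ≤ h) {x : ℝ} (hx : 0 ≤ x) :
    HasDerivAt (chiReal b c h)
      (2 * x - c - h * (b * Real.exp (-x * h)) / (1 - b * Real.exp (-x * h)) ^ 2) x := by
  have hs := (hasDerivAt_mul_exp_neg_mul b h x).const_sub 1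
  have hinv := hs.inv (one_sub_mul_exp_pos hb0 hb1 hh hx).ne'
  exact ((((hasDerivAt_id x).pow 2).sub ((hasDerivAt_id x).const_mul c)).add hinv).congr_deriv
    (by simp only [id]; ring)

theorem differentiableAt_chiReal (hb0 : 0 ≤ b) (hb1 : b < 1) (hh : 0 ≤ h) {x : ℝ} (hx : 0 ≤ x) :
    DifferentiableAt ℝ (chiReal b c h) x :=
  (hasDerivAt_chiReal hb0 hb1 hh hx).differentiableAt

theorem continuousOn_chiReal (hb0 : 0 ≤ b) (hb1 : b < 1) (hh : 0 ≤ h) :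
    ContinuousOn (chiReal b c h) (Ici 0) := fun _ hx =>
  (differentiableAt_chiReal hb0 hb1 hh hx).continuousAt.continuousWithinAt

theorem deriv_deriv_chiReal_pos (hb0 : 0 ≤ b) (hb1 : b < 1) (hh : 0 ≤ h) {x : ℝ} (hx : 0 < x) :
    0 < deriv (deriv (chiReal b c h)) x := by
  have heq : deriv (chiReal b c h) =ᶠ[𝓝 x] fun x =>
      2 * x - c - h * (b * Real.exp (-x * h)) / (1 - b * Real.exp (-x * h)) ^ 2 := by
    filter_upwards [lt_mem_nhds hx] with y hy
    exact (hasDerivAt_chiReal hb0 hb1 hh (le_of_lt hy)).deriv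
  have hpos := one_sub_mul_exp_pos hb0 hb1 hh hx.le
  have hs := hasDerivAt_mul_exp_neg_mul b h x
  have hd := (((hasDerivAt_id x).const_mul 2).sub_const c).sub
    ((hs.const_mul h).div ((hs.const_sub 1).pow 2) (pow_pos hpos 2).ne')
  have hd' : deriv (deriv (chiReal b c h)) x = 2 + h ^ 2 * (b * Real.exp (-x * h)) *
      (1 + b * Real.exp (-x * h)) / (1 - b * Real.exp (-x * h)) ^ 3 := by
    refine heq.deriv_eq.trans (hd.congr_deriv ?_).deriv
    have := hpos.ne'
    simp only [Pi.pow_apply]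
    generalize b * Real.exp (-x * h) = s at this ⊢
    field_simp
    ring
  rw [hd']
  positivity

theorem strictConvexOn_chiReal (hb0 : 0 ≤ b) (hb1 : b < 1) (hh : 0 ≤ h) :
    StrictConvexOn ℝ (Ici 0) (chiReal b c h) :=
  strictConvexOn_of_deriv2_pos (convex_Ici 0) (continuousOn_chiReal hb0 hb1 hh) fun x hx =>
    deriv_deriv_chiReal_pos hb0 hb1 hh (by simpa using hx)

theorem exists_isPositiveZeroPair_chiReal (hb0 : 0 ≤ b) (hb1 : b < 1) (hc : 0 < c) (hh : 0 ≤ h)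
    (hex : ∃ x ∈ Icc 0 c, chiReal b c h x ≤ 0) :
    ∃ l₂ l₁, IsPositiveZeroPair (chiReal b c h) l₂ l₁ := by
  have hpos : ∀ x, 0 ≤ x → x ^ 2 - c * x = 0 → 0 < chiReal b c h x := fun x hx h0 => by
    rw [chiReal, h0, zero_add]
    exact inv_pos.2 (one_sub_mul_exp_pos hb0 hb1 hh hx)
  exact exists_isPositiveZeroPair (strictConvexOn_chiReal hb0 hb1 hh)
    (continuousOn_chiReal hb0 hb1 hh) (hpos 0 le_rfl (by ring)) (hpos c hc.le (by ring)) hex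

theorem norm_mul_cexp (hb0 : 0 ≤ b) (h : ℝ) (z : ℂ) :
    ‖(b : ℂ) * Complex.exp (-z * h)‖ = b * Real.exp (-z.re * h) := by
  rw [norm_mul, Complex.norm_real, Real.norm_of_nonneg hb0, Complex.norm_exp,
    Complex.re_mul_ofReal, Complex.neg_re]

theorem le_norm_one_sub_mul_cexp (hb0 : 0 ≤ b) (h : ℝ) (z : ℂ) :
    1 - b * Real.exp (-z.re * h) ≤ ‖1 - (b : ℂ) * Complex.exp (-z * h)‖ := by
  simpa only [norm_mul_cexp hb0, norm_one] using
    norm_sub_norm_le (1 : ℂ) ((b : ℂ) * Complex.exp (-z * h))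

theorem one_sub_mul_cexp_ne_zero (hb0 : 0 ≤ b) (hb1 : b < 1) (hh : 0 ≤ h) {z : ℂ}
    (hz : 0 ≤ z.re) : 1 - (b : ℂ) * Complex.exp (-z * h) ≠ 0 :=
  norm_pos_iff.1 ((one_sub_mul_exp_pos hb0 hb1 hh hz).trans_le (le_norm_one_sub_mul_cexp hb0 h z))

theorem norm_inv_one_sub_mul_cexp_le (hb0 : 0 ≤ b) (hb1 : b < 1) (hh : 0 ≤ h) {z : ℂ}
    (hz : 0 ≤ z.re) :
    ‖(1 - (b : ℂ) * Complex.exp (-z * h))⁻¹‖ ≤ (1 - b * Real.exp (-z.re * h))⁻¹ := by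
  rw [norm_inv]
  exact inv_anti₀ (one_sub_mul_exp_pos hb0 hb1 hh hz) (le_norm_one_sub_mul_cexp hb0 h z)

theorem differentiableAt_chi (hb0 : 0 ≤ b) (hb1 : b < 1) (hh : 0 ≤ h) {z : ℂ} (hz : 0 ≤ z.re) :
    DifferentiableAt ℂ (chi b c h) z := by
  have := one_sub_mul_cexp_ne_zero hb0 hb1 hh hz
  unfold chi
  fun_prop (disch := assumption)

theorem analyticAt_chi (hb0 : 0 ≤ b) (hb1 : b < 1) (hh : 0 ≤ h) {z : ℂ} (hz : 0 < z.re) :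
    AnalyticAt ℂ (chi b c h) z :=
  DifferentiableOn.analyticAt (s := {z | 0 < z.re})
    (fun _ hw => (differentiableAt_chi hb0 hb1 hh (le_of_lt hw)).differentiableWithinAt)
    ((isOpen_lt continuous_const Complex.continuous_re).mem_nhds hz)

theorem deriv_ofReal_of_eventuallyEq {F : ℂ → ℂ} {f : ℝ → ℝ} {x : ℝ}
    (hF : DifferentiableAt ℂ F x) (heq : ∀ᶠ y : ℝ in 𝓝 x, F y = f y) :
    deriv F x = (deriv f x : ℝ) := by
  have hf : HasDerivAt f (deriv F x).re x := hF.hasDerivAt.real_of_complex.congr_of_eventuallyEq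
    (heq.mono fun y hy => (congrArg Complex.re hy).symm)
  exact hF.hasDerivAt.comp_ofReal.unique
    ((hf.deriv ▸ hf).ofReal_comp.congr_of_eventuallyEq heq)

theorem eventually_deriv_chi_ofReal (hb0 : 0 ≤ b) (hb1 : b < 1) (hh : 0 ≤ h) {x : ℝ} (hx : 0 < x) :
    ∀ᶠ y : ℝ in 𝓝 x, deriv (chi b c h) y = (deriv (chiReal b c h) y : ℝ) := by
  filter_upwards [lt_mem_nhds hx] with y hy
  exact deriv_ofReal_of_eventuallyEq (differentiableAt_chi hb0 hb1 hh (le_of_lt hy))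
    (Eventually.of_forall chi_ofReal)

theorem analyticOrderAt_chi_of_deriv_ne_zero (hb0 : 0 ≤ b) (hb1 : b < 1) (hh : 0 ≤ h) {x : ℝ}
    (hx : 0 < x) (h0 : chiReal b c h x = 0) (h1 : deriv (chiReal b c h) x ≠ 0) :
    analyticOrderAt (chi b c h) x = 1 := by
  refine (analyticAt_chi hb0 hb1 hh (z := x) hx).analyticOrderAt_eq_one_of_zero_deriv_ne_zero ?_ ?_
  · rw [chi_ofReal, h0, Complex.ofReal_zero]
  · rwa [(eventually_deriv_chi_ofReal hb0 hb1 hh hx).self_of_nhds, Complex.ofReal_ne_zero]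

theorem analyticOrderAt_chi_of_deriv_eq_zero (hb0 : 0 ≤ b) (hb1 : b < 1) (hh : 0 ≤ h) {x : ℝ}
    (hx : 0 < x) (h0 : chiReal b c h x = 0) (h1 : deriv (chiReal b c h) x = 0) :
    analyticOrderAt (chi b c h) x = 2 := by
  have han := analyticAt_chi (c := c) hb0 hb1 hh (z := x) hx
  have hderiv := eventually_deriv_chi_ofReal (c := c) hb0 hb1 hh hx
  refine (analyticOrderAt_eq_nat_iff_iteratedDeriv_eq_zero han (n := 2)).2 ⟨fun k hk => ?_, ?_⟩
  · interval_cases k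
    · rw [iteratedDeriv_zero, chi_ofReal, h0, Complex.ofReal_zero]
    · rw [iteratedDeriv_one, hderiv.self_of_nhds, h1, Complex.ofReal_zero]
  · rw [iteratedDeriv_succ, iteratedDeriv_one,
      deriv_ofReal_of_eventuallyEq han.deriv.differentiableAt hderiv, Complex.ofReal_ne_zero]
    exact (deriv_deriv_chiReal_pos hb0 hb1 hh hx).ne'

theorem analyticOrderAt_chi_eq (hb0 : 0 ≤ b) (hb1 : b < 1) (hh : 0 ≤ h) {l₂ l₁ x : ℝ}
    (hl : IsPositiveZeroPair (chiReal b c h) l₂ l₁) (hx : 0 < x) :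
    analyticOrderAt (chi b c h) x = (if x = l₂ then 1 else 0) + (if x = l₁ then 1 else 0) := by
  have hconv := strictConvexOn_chiReal (c := c) hb0 hb1 hh
  have hd : ∀ {y}, 0 < y → DifferentiableAt ℝ (chiReal b c h) y := fun hy =>
    differentiableAt_chiReal hb0 hb1 hh (le_of_lt hy)
  by_cases h0 : chiReal b c h x = 0
  · rcases hl.le.eq_or_lt with heq | hlt
    · obtain rfl : x = l₂ := (hl.eq_or_eq hx h0).elim id fun h => h.trans heq.symm
      rw [analyticOrderAt_chi_of_deriv_eq_zero hb0 hb1 hh hx h0 (hl.deriv_eq_zero heq),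
        if_pos rfl, if_pos heq, one_add_one_eq_two]
    · rcases hl.eq_or_eq hx h0 with rfl | rfl
      · rw [analyticOrderAt_chi_of_deriv_ne_zero hb0 hb1 hh hx h0
          (hl.deriv_left_neg hconv (hd hx) hlt).ne, if_pos rfl, if_neg hlt.ne, add_zero]
      · rw [analyticOrderAt_chi_of_deriv_ne_zero hb0 hb1 hh hx h0
          (hl.deriv_right_pos hconv (hd hx) hlt).ne', if_pos rfl, if_neg hlt.ne', zero_add]
  · rw [if_neg (by rintro rfl; exact h0 hl.eq_zero_left),
      if_neg (by rintro rfl; exact h0 hl.eq_zero_right), add_zero,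
      (analyticAt_chi hb0 hb1 hh (z := x) hx).analyticOrderAt_eq_zero, chi_ofReal]
    exact_mod_cast h0

/-- On the line `Re z = l`, the moduli of `z` and `z - c` are smallest at `z = l`, and that of
`(1 - b e^{-z h})⁻¹` is largest there. -/
theorem eq_ofReal_of_chi_eq_zero (hb0 : 0 ≤ b) (hb1 : b < 1) (hh : 0 ≤ h) {l : ℝ} (hl : 0 < l)
    (h0 : chiReal b c h l = 0) {z : ℂ} (hz : z.re = l) (hz0 : chi b c h z = 0) : z = l := by
  have hD := one_sub_mul_exp_pos hb0 hb1 hh hl.le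
  have hlc : l ≠ c := by
    rintro rfl
    exact (inv_pos.2 hD).ne' (by unfold chiReal at h0; linear_combination h0)
  have hle : ‖z‖ * ‖z - c‖ ≤ l * |l - c| := by
    calc ‖z‖ * ‖z - c‖ = ‖(1 - (b : ℂ) * Complex.exp (-z * h))⁻¹‖ := by
          rw [← norm_mul, ← norm_neg]
          congr 1
          unfold chi at hz0
          linear_combination -hz0
      _ ≤ (1 - b * Real.exp (-l * h))⁻¹ := by
          simpa only [hz] using norm_inv_one_sub_mul_cexp_le hb0 hb1 hh (hl.le.trans hz.ge)
      _ = -(l * (l - c)) := by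
          unfold chiReal at h0
          linear_combination h0
      _ ≤ l * |l - c| := by
          rw [← mul_neg]
          exact mul_le_mul_of_nonneg_left (neg_le_abs _) hl.le
  have him : z.im = 0 := by
    by_contra him
    have h1 : l < ‖z‖ := by simpa only [hz, abs_of_pos hl] using Complex.abs_re_lt_norm.2 him
    have h2 : |l - c| ≤ ‖z - c‖ := by simpa [hz] using Complex.abs_re_le_norm (z - c)
    exact hle.not_gt (mul_lt_mul h1 h2 (abs_pos.2 (sub_ne_zero.2 hlc)) (norm_nonneg z))
  exact Complex.ext hz him

theorem le_norm_chi (hb0 : 0 ≤ b) (hb1 : b < 1) (hh : 0 ≤ h) {z : ℂ} (hz : 0 ≤ z.re) :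
    z.im ^ 2 - (1 - b)⁻¹ ≤ ‖chi b c h z‖ := by
  have h1 : ‖(1 - (b : ℂ) * Complex.exp (-z * h))⁻¹‖ ≤ (1 - b)⁻¹ :=
    (norm_inv_one_sub_mul_cexp_le hb0 hb1 hh hz).trans <|
      inv_anti₀ (sub_pos.2 hb1) (sub_le_sub_left (mul_exp_neg_mul_le hb0 hh hz) 1)
  have h2 : z.im ^ 2 ≤ ‖z * (z - c)‖ := by
    have := Complex.abs_im_le_norm (z - c)
    rw [Complex.sub_im, Complex.ofReal_im, sub_zero] at this
    rw [norm_mul, ← sq_abs, sq]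
    exact mul_le_mul (Complex.abs_im_le_norm z) this (abs_nonneg _) (norm_nonneg _)
  have h3 : z * (z - c) = chi b c h z - (1 - (b : ℂ) * Complex.exp (-z * h))⁻¹ := by
    unfold chi
    ring
  rw [h3] at h2
  linarith [norm_sub_le (chi b c h z) (1 - (b : ℂ) * Complex.exp (-z * h))⁻¹]

theorem exists_strip_chi_ne_zero (hb0 : 0 ≤ b) (hb1 : b < 1) (hh : 0 ≤ h) {l : ℝ} (hl : 0 < l)
    (h0 : chiReal b c h l = 0) (hord : analyticOrderAt (chi b c h) l ≠ ⊤) :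
    ∃ ε > 0, ∀ z : ℂ, |z.re - l| ≤ ε → chi b c h z = 0 → z = l := by
  have hisolated : ∀ᶠ z in 𝓝[≠] (l : ℂ), chi b c h z ≠ 0 :=
    (analyticAt_chi hb0 hb1 hh (z := l) hl).eventually_eq_zero_or_eventually_ne_zero.resolve_left
      fun h1 => hord (analyticOrderAt_eq_top.2 h1)
  obtain ⟨U, hU, hUo, hlU⟩ := eventually_nhds_iff.1 (eventually_nhdsWithin_iff.1 hisolated)
  -- By `le_norm_chi`, all zeros with real part near `l` lie in this rectangle.
  let R : Set ℂ := Icc (l / 2) (2 * l) ×ℂ Icc (-√(1 - b)⁻¹) √(1 - b)⁻¹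
  have hR : IsCompact R := isCompact_Icc.reProdIm isCompact_Icc
  have hcont : ContinuousOn (chi b c h) R := fun z hz =>
    (differentiableAt_chi hb0 hb1 hh
      ((half_pos hl).le.trans hz.1.1)).continuousAt.continuousWithinAt
  let K : Set ℂ := (R ∩ chi b c h ⁻¹' {0}) \ U
  have hK : IsCompact K := (hR.of_isClosed_subset (hcont.preimage_isClosed_of_isClosed
    hR.isClosed isClosed_singleton) inter_subset_left).diff hUo
  have hlK : l ∉ Complex.re '' K := by
    rintro ⟨z, ⟨⟨-, hz0⟩, hzU⟩, hz⟩
    exact hzU (eq_ofReal_of_chi_eq_zero hb0 hb1 hh hl h0 hz hz0 ▸ hlU)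
  obtain ⟨ε, hε, hball⟩ := Metric.nhds_basis_closedBall.mem_iff.1 <| inter_mem
    ((hK.image Complex.continuous_re).isClosed.isOpen_compl.mem_nhds hlK)
    (Icc_mem_nhds (by linarith : l / 2 < l) (by linarith : l < 2 * l))
  refine ⟨ε, hε, fun z hz hz0 => ?_⟩
  obtain ⟨hzK, hzR⟩ := hball (Metric.mem_closedBall.2 hz)
  have him := le_norm_chi (c := c) hb0 hb1 hh ((half_pos hl).le.trans hzR.1)
  rw [hz0, norm_zero] at him
  by_contra hne
  exact hzK ⟨z, ⟨⟨⟨hzR, abs_le.1 (Real.abs_le_sqrt (by linarith))⟩, hz0⟩,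
    fun hzU => hU z hzU hne hz0⟩, rfl⟩

end Characteristic

section RegularizedInverse

theorem exists_regularized_inv {F : ℂ → ℂ} {a : ℂ} {m : ℕ} (hF : AnalyticAt ℂ F a)
    (hord : analyticOrderAt F a = m) :
    ∃ R : ℂ → ℂ, DifferentiableAt ℂ R a ∧ ∀ z ≠ a, R z = (z - a) ^ m / F z := by
  obtain ⟨g, hg, hga, hFg⟩ := hF.analyticOrderAt_eq_natCast.1 hord
  refine ⟨Function.update (fun z => (z - a) ^ m / F z) a (g a)⁻¹, ?_, fun z hz =>
    Function.update_of_ne hz _ _⟩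
  refine (hg.differentiableAt.inv hga).congr_of_eventuallyEq ?_
  filter_upwards [hFg] with w hw
  rcases eq_or_ne w a with rfl | hwa
  · exact Function.update_self _ _ _
  · rw [Function.update_of_ne hwa, hw, smul_eq_mul]
    exact div_mul_cancel_left₀ (pow_ne_zero m (sub_ne_zero.2 hwa)) _

theorem exists_norm_le_inv_one_add_sq {x₀ x₁ C M : ℝ} {G : ℂ → ℂ}
    (hG : ContinuousOn G (Complex.re ⁻¹' Icc x₀ x₁))
    (hC : ∀ z : ℂ, z.re ∈ Icc x₀ x₁ → M ≤ |z.im| → ‖G z‖ ≤ C * (1 + z.im ^ 2)⁻¹) :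
    ∃ C', ∀ z : ℂ, z.re ∈ Icc x₀ x₁ → ‖G z‖ ≤ C' * (1 + z.im ^ 2)⁻¹ := by
  have hpos : ∀ y : ℝ, 0 < 1 + y ^ 2 := fun y => by positivity
  have hcont : ContinuousOn (fun z : ℂ => (1 + z.im ^ 2) * ‖G z‖) (Icc x₀ x₁ ×ℂ Icc (-M) M) :=
    ContinuousOn.mul (by fun_prop) (hG.mono fun z hz => hz.1).norm
  obtain ⟨D, hD⟩ := (isCompact_Icc.reProdIm isCompact_Icc).exists_bound_of_continuousOn hcont
  refine ⟨max C D, fun z hz => ?_⟩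
  rcases le_or_gt M |z.im| with him | him
  · exact (hC z hz him).trans
      (mul_le_mul_of_nonneg_right (le_max_left _ _) (inv_nonneg.2 (hpos _).le))
  · rw [← div_eq_mul_inv, le_div_iff₀' (hpos _)]
    exact (le_abs_self _).trans ((hD z ⟨hz, abs_le.1 him.le⟩).trans (le_max_right _ _))

variable {b c h : ℝ}

/-- The pole of `1 / χ` at `l` is cancelled by the factor `((z - l) / z) ^ m`, which stays bounded
at `± i ∞`. -/
theorem exists_regularized_inv_chi (hb0 : 0 ≤ b) (hb1 : b < 1) (hh : 0 ≤ h) {l x₀ x₁ : ℝ} {m : ℕ}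
    (hl : 0 < l) (hord : analyticOrderAt (chi b c h) l = m) (hx₀ : 0 < x₀)
    (hstrip : ∀ z : ℂ, z.re ∈ Icc x₀ x₁ → chi b c h z = 0 → z = l) :
    ∃ Q : ℂ → ℂ, DifferentiableOn ℂ Q (Complex.re ⁻¹' Icc x₀ x₁) ∧
      (∃ C, ∀ z : ℂ, z.re ∈ Icc x₀ x₁ → ‖Q z‖ ≤ C * (1 + z.im ^ 2)⁻¹) ∧
      ∀ z : ℂ, z.re ∈ Icc x₀ x₁ → z ≠ l → Q z * chi b c h z = ((z - l) / z) ^ m := by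
  obtain ⟨R, hRl, hR⟩ := exists_regularized_inv (analyticAt_chi hb0 hb1 hh (z := l) hl) hord
  have hre : ∀ z : ℂ, z.re ∈ Icc x₀ x₁ → x₀ ≤ ‖z‖ := fun z hz =>
    hz.1.trans (Complex.re_le_norm z)
  have hne : ∀ z : ℂ, z.re ∈ Icc x₀ x₁ → z ≠ 0 := fun z hz =>
    norm_pos_iff.1 (hx₀.trans_le (hre z hz))
  have hQ : ∀ z ≠ (l : ℂ), R z / z ^ m = ((z - l) / z) ^ m / chi b c h z := fun z hz => by
    rw [hR z hz, div_pow, div_right_comm]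
  have hd : DifferentiableOn ℂ (fun z => R z / z ^ m) (Complex.re ⁻¹' Icc x₀ x₁) := fun z hz => by
    have hRz : DifferentiableAt ℂ R z := by
      rcases eq_or_ne z l with rfl | hzl
      · exact hRl
      · exact (((differentiableAt_id.sub_const _).pow m).div
          (differentiableAt_chi hb0 hb1 hh (hx₀.le.trans hz.1))
          (mt (hstrip z hz) hzl)).congr_of_eventuallyEq ((eventually_ne_nhds hzl).mono hR)
    exact (hRz.div (differentiableAt_id.pow m) (pow_ne_zero m (hne z hz))).differentiableWithinAt
  refine ⟨fun z => R z / z ^ m, hd, exists_norm_le_inv_one_add_sq (M := √(2 * (1 - b)⁻¹ + 1))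
    (C := (1 + l / x₀) ^ m * 2) hd.continuousOn fun z hz him => ?_, fun z hz hzl => ?_⟩
  · have him' : 2 * (1 - b)⁻¹ + 1 ≤ z.im ^ 2 := (Real.sqrt_le_left (abs_nonneg _)).1 him |>.trans_eq
      (sq_abs _)
    have hinv : 0 < (1 - b)⁻¹ := inv_pos.2 (sub_pos.2 hb1)
    have hzl : z ≠ l := by
      rintro rfl
      rw [Complex.ofReal_im] at him'
      linarith
    have hchi : (1 + z.im ^ 2) / 2 ≤ ‖chi b c h z‖ := by
      linarith [le_norm_chi (c := c) hb0 hb1 hh (hx₀.le.trans hz.1)]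
    have hquot : ‖(z - l) / z‖ ≤ 1 + l / x₀ := by
      rw [sub_div, div_self (hne z hz)]
      refine (norm_sub_le _ _).trans ?_
      rw [norm_one, norm_div, Complex.norm_real, Real.norm_of_nonneg hl.le]
      gcongr
      exact hre z hz
    rw [hQ z hzl, norm_div, norm_pow]
    calc ‖(z - l) / z‖ ^ m / ‖chi b c h z‖ ≤ (1 + l / x₀) ^ m / ((1 + z.im ^ 2) / 2) := by gcongr
      _ = (1 + l / x₀) ^ m * 2 * (1 + z.im ^ 2)⁻¹ := by
        rw [div_div_eq_mul_div, div_eq_mul_inv]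
  · beta_reduce
    rw [hQ z hzl, div_mul_cancel₀ _ (mt (hstrip z hz) hzl)]

end RegularizedInverse

section ReduceMode

variable {l μ μ₁ μ₂ x : ℝ} {f : ℝ → ℝ}

/-- Annihilates the mode `e^{l t}`: the Laplace transform is multiplied by `(z - l) / z`, which
lowers the order of a pole at `l` by one. -/
noncomputable def reduceMode (l : ℝ) (f : ℝ → ℝ) (t : ℝ) : ℝ :=
  f t - l * ∫ s in Iic t, f s

theorem StripBounded.integral_Iic (hf : StripBounded μ₁ μ₂ f) (hμ₁ : 0 < μ₁) (hμ₂ : 0 < μ₂) :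
    StripBounded μ₁ μ₂ fun t => ∫ s in Iic t, f s where
  continuous := continuous_iff_continuousAt.2 fun t => (hasDerivAt_integral_Iic hf.continuous
    (hf.left.integrableOn_Iic_of_pos hf.continuous hμ₁) t).continuousAt
  left := hf.left.integral_Iic hμ₁
  right := hf.right.integral_Iic hμ₂

protected theorem StripBounded.reduceMode (hf : StripBounded μ₁ μ₂ f) (hμ₁ : 0 < μ₁) (hμ₂ : 0 < μ₂)
    (l : ℝ) : StripBounded μ₁ μ₂ (reduceMode l f) :=
  hf.sub ((hf.integral_Iic hμ₁ hμ₂).const_mul l)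

theorem StripBounded.laplace_reduceMode (hf : StripBounded μ₁ μ₂ f) (hμ₁ : 0 < μ₁) (l : ℝ) {z : ℂ}
    (hz : z.re ∈ Ioo μ₁ μ₂) : laplace (reduceMode l f) z = (z - l) / z * laplace f z := by
  have hI := hf.integral_Iic hμ₁ (hμ₁.trans (hz.1.trans hz.2))
  have hderiv := laplace_deriv (hasDerivAt_integral_Iic hf.continuous
    (hf.left.integrableOn_Iic_of_pos hf.continuous hμ₁)) (hI.integrable hz) (hf.integrable hz)
  have hz0 : z ≠ 0 := by
    rintro rfl
    exact (hμ₁.trans hz.1).ne' Complex.zero_re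
  calc laplace (reduceMode l f) z
      = laplace f z - l * laplace (fun t => ∫ s in Iic t, f s) z := by
        rw [← laplace_const_mul]
        exact laplace_sub (hf.integrable hz) ((hI.const_mul l).integrable hz)
    _ = (z - l) / z * laplace f z := by
        rw [hderiv]
        field_simp

theorem StripBounded.iterate_reduceMode (hf : StripBounded μ₁ μ₂ f) (hμ₁ : 0 < μ₁) (hμ₂ : 0 < μ₂)
    (l : ℝ) (m : ℕ) : StripBounded μ₁ μ₂ ((reduceMode l)^[m] f) := by
  induction m with
  | zero => exact hf
  | succ m ih =>
    rw [Function.iterate_succ_apply']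
    exact ih.reduceMode hμ₁ hμ₂ l

theorem StripBounded.laplace_iterate_reduceMode (hf : StripBounded μ₁ μ₂ f) (hμ₁ : 0 < μ₁) (l : ℝ)
    {z : ℂ} (hz : z.re ∈ Ioo μ₁ μ₂) (m : ℕ) :
    laplace ((reduceMode l)^[m] f) z = ((z - l) / z) ^ m * laplace f z := by
  induction m with
  | zero => simp
  | succ m ih =>
    have hm := hf.iterate_reduceMode hμ₁ (hμ₁.trans (hz.1.trans hz.2)) l m
    rw [Function.iterate_succ_apply', hm.laplace_reduceMode hμ₁ l hz, ih, pow_succ', mul_assoc]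

theorem exists_eq_add_integral_Iic {Q d : ℝ → ℝ} {a : ℝ} (hQ : ∀ t, HasDerivAt Q (a + d t) t)
    (hd : Continuous d) (hi : ∀ t, IntegrableOn d (Iic t)) :
    ∃ B, ∀ t, Q t = a * t + B + ∫ s in Iic t, d s := by
  have hconst : ∀ t, HasDerivAt (fun t => Q t - a * t - ∫ s in Iic t, d s) 0 t := fun t =>
    (((hQ t).sub ((hasDerivAt_id t).const_mul a)).sub
      (hasDerivAt_integral_Iic hd hi t)).congr_deriv (by ring)
  refine ⟨Q 0 - a * 0 - ∫ s in Iic 0, d s, fun t => ?_⟩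
  linear_combination is_const_of_deriv_eq_zero (fun t => (hconst t).differentiableAt)
    (fun t => (hconst t).deriv) t 0

/-- For the primitive `q` of `f`, `(e^{-l t} q)' = e^{-l t} (f - l q)`, so that undoing `reduceMode`
integrates the coefficient of `e^{l t}` once. -/
theorem ExpBounded.expansion_of_reduceMode {a : ℝ} (hf : ExpBounded μ f) (hcont : Continuous f)
    (hμ : 0 < μ) (hx : l < x)
    (h : ExpBounded x fun t => reduceMode l f t - a * Real.exp (l * t)) :
    ∃ B, ExpBounded x fun t => f t - (l * a * t + B) * Real.exp (l * t) := by
  have hE : ∀ t, Real.exp (l * t) * Real.exp (-l * t) = 1 := fun t => by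
    rw [← Real.exp_add]
    simp
  have hq := hasDerivAt_integral_Iic hcont (hf.integrableOn_Iic_of_pos hcont hμ)
  have hqcont : Continuous fun t => ∫ s in Iic t, f s :=
    continuous_iff_continuousAt.2 fun t => (hq t).continuousAt
  set d : ℝ → ℝ := fun t => Real.exp (-l * t) * (reduceMode l f t - a * Real.exp (l * t)) with hd
  have hdcont : Continuous d := by
    unfold d reduceMode
    fun_prop
  have hdb : ExpBounded (x - l) d := by simpa only [neg_add_eq_sub] using h.exp_mul (-l)
  have hQ : ∀ t, HasDerivAt (fun t => Real.exp (-l * t) * ∫ s in Iic t, f s) (a + d t) t :=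
    fun t => ((((hasDerivAt_id t).const_mul (-l)).exp).mul (hq t)).congr_deriv <| by
      simp only [hd, id, reduceMode]
      linear_combination a * hE t
  obtain ⟨B, hB⟩ := exists_eq_add_integral_Iic hQ hdcont
    (hdb.integrableOn_Iic_of_pos hdcont (sub_pos.2 hx))
  have hJ : ExpBounded x fun t => Real.exp (l * t) * ∫ s in Iic t, d s := by
    simpa only [add_sub_cancel] using (hdb.integral_Iic (sub_pos.2 hx)).exp_mul l
  refine ⟨a + l * B, (IsBigO.add h (IsBigO.const_mul_left hJ l)).congr_left fun t => ?_⟩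
  simp only [reduceMode]
  linear_combination -l * Real.exp (l * t) * hB t + l * (∫ s in Iic t, f s) * hE t

end ReduceMode

section ModeReduction

variable {b c h l μ₁ μ₂ ν₁ ν₂ x₀ x₁ : ℝ} {f N : ℝ → ℝ} {m : ℕ}

/-- With `Q` the regularized inverse of `χ`, the product `Q · L N` continues the Laplace transform
of the reduced function across the line `Re z = l`. -/
theorem StripBounded.expBounded_iterate_reduceMode (hb0 : 0 ≤ b) (hb1 : b < 1) (hh : 0 ≤ h)
    (hf : StripBounded μ₁ μ₂ f) (hN : StripBounded ν₁ ν₂ N) (hμ₁ : 0 < μ₁)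
    (hx₀ : x₀ ∈ Ioo μ₁ μ₂) (hν₁ : ν₁ < x₀) (hν₂ : x₁ < ν₂) (hl : l ∈ Ioc x₀ x₁)
    (hord : analyticOrderAt (chi b c h) l = m)
    (hstrip : ∀ z : ℂ, z.re ∈ Icc x₀ x₁ → chi b c h z = 0 → z = l)
    (hL : ∀ z : ℂ, z.re = x₀ → chi b c h z * laplace f z = laplace N z) :
    ExpBounded x₁ ((reduceMode l)^[m] f) := by
  have h0x₀ := hμ₁.trans hx₀.1
  obtain ⟨Q, hQd, ⟨C, hC⟩, hQ⟩ :=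
    exists_regularized_inv_chi hb0 hb1 hh (h0x₀.trans hl.1) hord h0x₀ hstrip
  obtain ⟨C₁, C₂, hC₁, hC₂, hNb⟩ := hN.norm_laplace_le
  have hstripN : ∀ z : ℂ, z.re ∈ Icc x₀ x₁ → z.re ∈ Ioo ν₁ ν₂ := fun z hz =>
    ⟨hν₁.trans_le hz.1, hz.2.trans_lt hν₂⟩
  have hNle : ∀ z : ℂ, z.re ∈ Icc x₀ x₁ →
      ‖laplace N z‖ ≤ C₁ / (x₀ - ν₁) + C₂ / (ν₂ - x₁) := fun z hz => by
    refine (hNb z (hstripN z hz)).trans ?_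
    exact add_le_add
      (div_le_div_of_nonneg_left hC₁ (sub_pos.2 hν₁) (sub_le_sub_right hz.1 _))
      (div_le_div_of_nonneg_left hC₂ (sub_pos.2 hν₂) (sub_le_sub_left hz.2 _))
  have hbound : ∀ z : ℂ, z.re ∈ Icc x₀ x₁ → ‖Q z * laplace N z‖ ≤
      C * (C₁ / (x₀ - ν₁) + C₂ / (ν₂ - x₁)) * (1 + z.im ^ 2)⁻¹ := fun z hz => by
    rw [norm_mul, mul_right_comm]
    exact mul_le_mul (hC z hz) (hNle z hz) (norm_nonneg _) ((norm_nonneg _).trans (hC z hz))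
  refine (hf.iterate_reduceMode hμ₁ (h0x₀.trans hx₀.2) l m).expBounded_of_laplace_continuation hx₀
    (hl.1.le.trans hl.2) (hQd.mul (hN.differentiableOn_laplace.mono hstripN)) hbound fun y => ?_
  have hre : ((x₀ : ℂ) + y * Complex.I).re = x₀ := by simp
  have hne : (x₀ : ℂ) + y * Complex.I ≠ l := fun h =>
    hl.1.ne (hre.symm.trans (congrArg Complex.re h))
  rw [Pi.mul_apply, hf.laplace_iterate_reduceMode hμ₁ l (by rwa [hre]), ← hL _ hre, ← mul_assoc,
    hQ _ ⟨hre.ge, hre.trans_le (hl.1.le.trans hl.2)⟩ hne]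

end ModeReduction

section MonotoneFront

/-- The facts about a monotone front `φ` and `ψ = B φ` used in its asymptotic analysis; `h = c τ` is
the delay, and the series defining `ψ` enters only through `ψ t = φ t + b ψ (t - h)`. -/
structure IsMonotoneFront (b c h : ℝ) (φ ψ : ℝ → ℝ) : Prop where
  b_nonneg : 0 ≤ b
  b_lt_one : b < 1
  c_pos : 0 < c
  h_nonneg : 0 ≤ h
  contDiff : ContDiff ℝ 2 φ
  mono : Monotone φ
  tendsto_atBot : Tendsto φ atBot (𝓝 0)
  tendsto_atTop : Tendsto φ atTop (𝓝 1)
  continuous_psi : Continuous ψ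
  mono_psi : Monotone ψ
  psi_nonneg : ∀ t, 0 ≤ ψ t
  psi_eq : ∀ t, ψ t = φ t + b * ψ (t - h)
  equation : ∀ t, deriv (deriv φ) t - c * deriv φ t + ψ t * (1 - (1 - b) * ψ (t - h)) = 0

theorem neutralB_eq_add {b c τ t : ℝ} {φ : ℝ → ℝ}
    (hs : Summable fun j : ℕ => b ^ j * φ (t - j * (c * τ))) :
    neutralB b c τ φ t = φ t + b * neutralB b c τ φ (t - c * τ) := by
  unfold neutralB
  rw [hs.tsum_eq_zero_add, ← tsum_mul_left]
  congr 1
  · simp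
  · refine tsum_congr fun j => ?_
    rw [pow_succ', mul_assoc]
    congr 3
    push_cast
    ring

theorem IsProfileSolution.isMonotoneFront {b c τ : ℝ} {φ : ℝ → ℝ} (hb0 : 0 ≤ b) (hb1 : b < 1)
    (hc : 0 < c) (hτ : 0 ≤ τ) (hφ : IsProfileSolution b c τ φ) (hmono : Monotone φ) :
    IsMonotoneFront b c (c * τ) φ (neutralB b c τ φ) := by
  have h0 : ∀ t, 0 ≤ φ t := hmono.le_of_tendsto hφ.tendsto_atBot
  have h1 : ∀ t, φ t ≤ 1 := hmono.ge_of_tendsto hφ.tendsto_atTop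
  have hcont := hφ.contDiff.continuous
  have hgeom := summable_geometric_of_lt_one hb0 hb1
  have hterm0 : ∀ (j : ℕ) t, 0 ≤ b ^ j * φ (t - j * (c * τ)) := fun j t =>
    mul_nonneg (pow_nonneg hb0 j) (h0 _)
  have hterm1 : ∀ (j : ℕ) t, b ^ j * φ (t - j * (c * τ)) ≤ b ^ j := fun j t =>
    mul_le_of_le_one_right (pow_nonneg hb0 j) (h1 _)
  have hs : ∀ t, Summable fun j : ℕ => b ^ j * φ (t - j * (c * τ)) := fun t =>
    hgeom.of_nonneg_of_le (hterm0 · t) (hterm1 · t)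
  exact
    { b_nonneg := hb0
      b_lt_one := hb1
      c_pos := hc
      h_nonneg := mul_nonneg hc.le hτ
      contDiff := hφ.contDiff
      mono := hmono
      tendsto_atBot := hφ.tendsto_atBot
      tendsto_atTop := hφ.tendsto_atTop
      continuous_psi := continuous_tsum (fun j => by fun_prop) hgeom fun j t => by
        rw [Real.norm_of_nonneg (hterm0 j t)]
        exact hterm1 j t
      mono_psi := fun s t hst => (hs s).tsum_le_tsum (fun j => mul_le_mul_of_nonneg_left
        (hmono (sub_le_sub_right hst _)) (pow_nonneg hb0 j)) (hs t)
      psi_nonneg := fun t => tsum_nonneg (hterm0 · t)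
      psi_eq := fun t => neutralB_eq_add (hs t)
      equation := hφ.equation }

/-- The quadratic part `(1 - b) ψ (S ψ)` of the reaction term. -/
noncomputable def quadraticTerm (b h : ℝ) (ψ : ℝ → ℝ) (t : ℝ) : ℝ :=
  (1 - b) * (ψ t * ψ (t - h))

namespace IsMonotoneFront

variable {b c h : ℝ} {φ ψ : ℝ → ℝ}

theorem one_sub_b_pos (H : IsMonotoneFront b c h φ ψ) : 0 < 1 - b :=
  sub_pos.2 H.b_lt_one

theorem nonneg (H : IsMonotoneFront b c h φ ψ) (t : ℝ) : 0 ≤ φ t :=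
  H.mono.le_of_tendsto H.tendsto_atBot t

theorem le_one (H : IsMonotoneFront b c h φ ψ) (t : ℝ) : φ t ≤ 1 :=
  H.mono.ge_of_tendsto H.tendsto_atTop t

theorem le_psi (H : IsMonotoneFront b c h φ ψ) (t : ℝ) : φ t ≤ ψ t := by
  rw [H.psi_eq t]
  exact le_add_of_nonneg_right (mul_nonneg H.b_nonneg (H.psi_nonneg _))

theorem psi_sub_le (H : IsMonotoneFront b c h φ ψ) (t : ℝ) : ψ (t - h) ≤ ψ t :=
  H.mono_psi (sub_le_self t H.h_nonneg)

theorem one_sub_mul_psi_le (H : IsMonotoneFront b c h φ ψ) (t : ℝ) : (1 - b) * ψ t ≤ φ t := by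
  linarith [H.psi_eq t, mul_le_mul_of_nonneg_left (H.psi_sub_le t) H.b_nonneg]

theorem one_sub_mul_psi_le_one (H : IsMonotoneFront b c h φ ψ) (t : ℝ) : (1 - b) * ψ t ≤ 1 :=
  (H.one_sub_mul_psi_le t).trans (H.le_one t)

theorem psi_le (H : IsMonotoneFront b c h φ ψ) (t : ℝ) : ψ t ≤ (1 - b)⁻¹ * φ t :=
  (le_inv_mul_iff₀ H.one_sub_b_pos).2 (H.one_sub_mul_psi_le t)

theorem tendsto_psi_atBot (H : IsMonotoneFront b c h φ ψ) : Tendsto ψ atBot (𝓝 0) := by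
  refine squeeze_zero H.psi_nonneg H.psi_le ?_
  simpa using H.tendsto_atBot.const_mul (1 - b)⁻¹

theorem hasDerivAt (H : IsMonotoneFront b c h φ ψ) (t : ℝ) : HasDerivAt φ (deriv φ t) t :=
  (H.contDiff.differentiable two_ne_zero t).hasDerivAt

theorem contDiff_deriv (H : IsMonotoneFront b c h φ ψ) : ContDiff ℝ 1 (deriv φ) :=
  ((contDiff_succ_iff_deriv (n := 1)).1 H.contDiff).2.2

theorem hasDerivAt_deriv (H : IsMonotoneFront b c h φ ψ) (t : ℝ) :
    HasDerivAt (deriv φ) (deriv (deriv φ) t) t :=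
  (H.contDiff_deriv.differentiable one_ne_zero t).hasDerivAt

theorem deriv_deriv_eq (H : IsMonotoneFront b c h φ ψ) (t : ℝ) :
    deriv (deriv φ) t = c * deriv φ t - ψ t + quadraticTerm b h ψ t := by
  unfold quadraticTerm
  linarith [H.equation t]

theorem quadraticTerm_nonneg (H : IsMonotoneFront b c h φ ψ) (t : ℝ) :
    0 ≤ quadraticTerm b h ψ t :=
  mul_nonneg H.one_sub_b_pos.le (mul_nonneg (H.psi_nonneg t) (H.psi_nonneg _))

theorem quadraticTerm_le_psi (H : IsMonotoneFront b c h φ ψ) (t : ℝ) :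
    quadraticTerm b h ψ t ≤ ψ t := by
  unfold quadraticTerm
  rw [mul_left_comm]
  exact mul_le_of_le_one_right (H.psi_nonneg t) (H.one_sub_mul_psi_le_one _)

theorem antitone_flux (H : IsMonotoneFront b c h φ ψ) :
    Antitone fun t => deriv φ t - c * φ t := by
  refine antitone_of_hasDerivAt_nonpos
    (fun t => (H.hasDerivAt_deriv t).sub ((H.hasDerivAt t).const_mul c)) fun t => ?_
  rw [Pi.zero_apply]
  linarith [H.deriv_deriv_eq t, H.quadraticTerm_le_psi t]

theorem deriv_le (H : IsMonotoneFront b c h φ ψ) (t : ℝ) : deriv φ t ≤ c * φ t := by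
  have hlim : Tendsto (fun s => φ (s + 1) - φ s) atBot (𝓝 (0 - 0)) :=
    (H.tendsto_atBot.comp (tendsto_atBot_add_const_right _ 1 tendsto_id)).sub H.tendsto_atBot
  rw [sub_zero] at hlim
  refine sub_nonpos.1 (ge_of_tendsto hlim (eventually_atBot.2 ⟨t - 1, fun s hs => ?_⟩))
  obtain ⟨ξ, hξ, hslope⟩ := exists_deriv_eq_slope φ (lt_add_one s)
    H.contDiff.continuous.continuousOn (H.contDiff.differentiable two_ne_zero).differentiableOn
  rw [add_sub_cancel_left, div_one] at hslope
  calc deriv φ t - c * φ t ≤ deriv φ ξ - c * φ ξ := H.antitone_flux (by linarith [hξ.2])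
    _ ≤ deriv φ ξ := sub_le_self _ (mul_nonneg H.c_pos.le (H.nonneg ξ))
    _ = φ (s + 1) - φ s := hslope

theorem pos (H : IsMonotoneFront b c h φ ψ) (t : ℝ) : 0 < φ t := by
  refine (H.nonneg t).lt_of_ne' fun h0 => ?_
  have hright : ∀ s, t ≤ s → φ s ≤ 0 := fun s hs => by
    have hle := antitone_exp_mul_of_deriv_le H.hasDerivAt H.deriv_le hs
    simp only [h0, mul_zero] at hle
    exact nonpos_of_mul_nonpos_right hle (Real.exp_pos _)
  exact zero_lt_one.not_ge (le_of_tendsto H.tendsto_atTop (eventually_atTop.2 ⟨t, hright⟩))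

theorem psi_pos (H : IsMonotoneFront b c h φ ψ) (t : ℝ) : 0 < ψ t :=
  (H.pos t).trans_le (H.le_psi t)

theorem quadraticTerm_pos (H : IsMonotoneFront b c h φ ψ) (t : ℝ) : 0 < quadraticTerm b h ψ t :=
  mul_pos H.one_sub_b_pos (mul_pos (H.psi_pos t) (H.psi_pos _))

theorem eq_one_of_deriv_eq_zero (H : IsMonotoneFront b c h φ ψ) {t : ℝ} (ht : deriv φ t = 0) :
    φ (t - h) = 1 := by
  have hmin : IsLocalMin (deriv φ) t := Eventually.of_forall fun s => by
    rw [ht]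
    exact H.mono.deriv_nonneg
  have heq := H.equation t
  rw [hmin.deriv_eq_zero, ht, mul_zero, sub_zero, zero_add] at heq
  have hψ := (mul_eq_zero.1 heq).resolve_left (H.psi_pos t).ne'
  linarith [H.one_sub_mul_psi_le (t - h), H.le_one (t - h)]

theorem deriv_eq_zero_of_eq_one (H : IsMonotoneFront b c h φ ψ) {t : ℝ} (ht : φ t = 1) :
    deriv φ t = 0 :=
  IsLocalMax.deriv_eq_zero (Eventually.of_forall fun s => (H.le_one s).trans_eq ht.symm)

theorem ne_one_of_delay_pos (H : IsMonotoneFront b c h φ ψ) (hh : 0 < h) (t : ℝ) : φ t ≠ 1 := by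
  intro ht
  have hstep : ∀ n : ℕ, φ (t - n * h) = 1 := fun n => by
    induction n with
    | zero => simpa using ht
    | succ n ih =>
      rw [← H.eq_one_of_deriv_eq_zero (H.deriv_eq_zero_of_eq_one ih)]
      congr 1
      push_cast
      ring
  have hbot : Tendsto (fun n : ℕ => t - n * h) atTop atBot :=
    tendsto_atBot_add_const_left _ t
      (tendsto_neg_atTop_atBot.comp (tendsto_natCast_atTop_atTop.atTop_mul_const hh))
  exact zero_ne_one (tendsto_nhds_unique (H.tendsto_atBot.comp hbot)
    (tendsto_const_nhds.congr fun n => (hstep n).symm))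

/-- Without delay the equation is an ordinary differential equation with equilibrium `1`, which is
reached no faster than at the exponential rate `√(1 - b)⁻¹`. -/
theorem deriv_le_sqrt_mul_one_sub (H : IsMonotoneFront b c 0 φ ψ) {t : ℝ} (ht : φ t = 1) (s : ℝ) :
    deriv φ s ≤ √(1 - b)⁻¹ * (1 - φ s) := by
  rcases le_total t s with hts | hst
  · have hs : φ s = 1 := (H.le_one s).antisymm (ht.symm.trans_le (H.mono hts))
    rw [H.deriv_eq_zero_of_eq_one hs, hs, sub_self, mul_zero]
  set r := √(1 - b)⁻¹
  have hr2 : r * r = (1 - b)⁻¹ := Real.mul_self_sqrt (inv_nonneg.2 H.one_sub_b_pos.le)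
  have hψ : ∀ u, (1 - b) * ψ u = φ u := fun u => by
    have heq := H.psi_eq u
    rw [sub_zero] at heq
    linarith
  have hψ' : ∀ u, ψ u = r * r * φ u := fun u => by
    rw [hr2, ← hψ u, inv_mul_cancel_left₀ H.one_sub_b_pos.ne']
  have hf : ∀ u, HasDerivAt (fun u => r * (1 - φ u) - deriv φ u)
      (r * -deriv φ u - deriv (deriv φ) u) u := fun u =>
    (((H.hasDerivAt u).const_sub 1).const_mul r).sub (H.hasDerivAt_deriv u)
  have hle : ∀ u, r * -deriv φ u - deriv (deriv φ) u
      ≤ (c + r) * (r * (1 - φ u) - deriv φ u) := fun u => by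
    have hc : 0 ≤ c * r * (1 - φ u) := mul_nonneg (mul_nonneg H.c_pos.le (Real.sqrt_nonneg _))
      (sub_nonneg.2 (H.le_one u))
    have heq := H.equation u
    rw [sub_zero, hψ, hψ'] at heq
    linarith [mul_self_nonneg (r * (1 - φ u))]
  have hanti := antitone_exp_mul_of_deriv_le hf hle hst
  simp only [ht, H.deriv_eq_zero_of_eq_one ht, sub_self, mul_zero] at hanti
  exact sub_nonneg.1 (nonneg_of_mul_nonneg_right hanti (Real.exp_pos _))

theorem ne_one_of_delay_zero (H : IsMonotoneFront b c 0 φ ψ) (t : ℝ) : φ t ≠ 1 := by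
  intro ht
  have hanti := antitone_exp_mul_of_deriv_le (a := -√(1 - b)⁻¹)
    (fun s => (H.hasDerivAt s).sub_const 1)
    fun s => (H.deriv_le_sqrt_mul_one_sub ht s).trans_eq (by ring)
  have hleft : ∀ s ≤ t, 1 ≤ φ s := fun s hs => by
    have hle := hanti hs
    simp only [ht, sub_self, mul_zero] at hle
    exact sub_nonneg.1 (nonneg_of_mul_nonneg_right hle (Real.exp_pos _))
  exact zero_lt_one.not_ge (ge_of_tendsto H.tendsto_atBot (eventually_atBot.2 ⟨t, hleft⟩))

theorem deriv_pos (H : IsMonotoneFront b c h φ ψ) (t : ℝ) : 0 < deriv φ t := by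
  refine H.mono.deriv_nonneg.lt_of_ne' fun h0 => ?_
  have h1 := H.eq_one_of_deriv_eq_zero h0
  rcases H.h_nonneg.eq_or_lt with rfl | hh
  · exact H.ne_one_of_delay_zero _ h1
  · exact H.ne_one_of_delay_pos hh _ h1

end IsMonotoneFront

end MonotoneFront

section Growth

theorem of_step_of_le {P : ℝ → Prop} {δ η x₁ : ℝ} (hη : 0 < η) (hδ : P δ) (hδx : δ ≤ x₁)
    (hstep : ∀ y x, δ ≤ y → y < x → x ≤ y + η → x ≤ x₁ → P y → P x) : P x₁ := by
  have hmin : ∀ n : ℕ, P (min (δ + n * η) x₁) := fun n => by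
    induction n with
    | zero => simpa [hδx] using hδ
    | succ n ih =>
      have hn : δ + (n + 1 : ℕ) * η = δ + n * η + η := by push_cast; ring
      rcases le_or_gt x₁ (δ + n * η) with h | h
      · rw [min_eq_right h] at ih
        rwa [hn, min_eq_right (by linarith)]
      · rw [min_eq_left h.le] at ih
        refine hstep (δ + n * η) _ (le_add_of_nonneg_right (by positivity)) ?_ ?_
          (min_le_right _ _) ih
        · exact lt_min (by rw [hn]; linarith) h
        · exact (min_le_left _ _).trans_eq hn
  obtain ⟨n, hn⟩ := exists_nat_ge ((x₁ - δ) / η)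
  have hle : x₁ ≤ δ + n * η := by linarith [(div_le_iff₀ hη).1 hn]
  simpa [hle] using hmin n

theorem expBounded_of_integral_exp_mul_le {f : ℝ → ℝ} {x K : ℝ} (hmono : Monotone f)
    (h0 : ∀ t, 0 ≤ f t) (hx : 0 < x)
    (hi : ∀ t, IntegrableOn (fun s => Real.exp (-x * s) * f s) (Ioi t))
    (hK : ∀ t, ∫ s in Ioi t, Real.exp (-x * s) * f s ≤ K) : ExpBounded x f := by
  refine ExpBounded.of_le (C := K * x) fun t => ?_
  have hneg : -x < 0 := neg_lt_zero.2 hx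
  have hle : f t * (Real.exp (-x * t) / x) ≤ K := by
    calc f t * (Real.exp (-x * t) / x) = ∫ s in Ioi t, f t * Real.exp (-x * s) := by
          rw [integral_const_mul, integral_exp_mul_Ioi hneg, neg_div_neg_eq]
      _ ≤ ∫ s in Ioi t, Real.exp (-x * s) * f s :=
          setIntegral_mono_on ((integrableOn_exp_mul_Ioi hneg t).const_mul _) (hi t)
            measurableSet_Ioi fun s hs => by
              rw [mul_comm]
              exact mul_le_mul_of_nonneg_left (hmono (le_of_lt hs)) (Real.exp_pos _).le
      _ ≤ K := hK t
  rw [abs_of_nonneg (h0 t)]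
  rw [neg_mul, Real.exp_neg, mul_div_assoc', div_le_iff₀ hx, ← div_eq_mul_inv,
    div_le_iff₀ (Real.exp_pos _)] at hle
  exact hle

namespace IsMonotoneFront

variable {b c h x y : ℝ} {φ ψ : ℝ → ℝ}

theorem expBounded_zero (H : IsMonotoneFront b c h φ ψ) : ExpBounded 0 φ :=
  ExpBounded.of_abs_le fun t => (abs_of_nonneg (H.nonneg t)).trans_le (H.le_one t)

theorem psi_isBigO (H : IsMonotoneFront b c h φ ψ) : ψ =O[⊤] φ :=
  isBigO_top.2 ⟨(1 - b)⁻¹, fun t => by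
    rw [Real.norm_of_nonneg (H.psi_nonneg t), Real.norm_of_nonneg (H.nonneg t)]
    exact H.psi_le t⟩

theorem deriv_isBigO (H : IsMonotoneFront b c h φ ψ) : deriv φ =O[⊤] φ :=
  isBigO_top.2 ⟨c, fun t => by
    rw [Real.norm_of_nonneg H.mono.deriv_nonneg, Real.norm_of_nonneg (H.nonneg t)]
    exact H.deriv_le t⟩

theorem continuous_deriv (H : IsMonotoneFront b c h φ ψ) : Continuous (deriv φ) :=
  H.contDiff_deriv.continuous

theorem stripBounded (H : IsMonotoneFront b c h φ ψ) (hφ : ExpBounded y φ) : StripBounded 0 y φ :=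
  ⟨H.contDiff.continuous, H.expBounded_zero, hφ⟩

theorem stripBounded_psi (H : IsMonotoneFront b c h φ ψ) (hφ : ExpBounded y φ) :
    StripBounded 0 y ψ :=
  ⟨H.continuous_psi, H.psi_isBigO.trans H.expBounded_zero, H.psi_isBigO.trans hφ⟩

theorem stripBounded_deriv (H : IsMonotoneFront b c h φ ψ) (hφ : ExpBounded y φ) :
    StripBounded 0 y (deriv φ) :=
  ⟨H.continuous_deriv, H.deriv_isBigO.trans H.expBounded_zero, H.deriv_isBigO.trans hφ⟩

theorem stripBounded_quadraticTerm (H : IsMonotoneFront b c h φ ψ) (hφ : ExpBounded y φ) :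
    StripBounded 0 (2 * y) (quadraticTerm b h ψ) := by
  have hψ := H.stripBounded_psi hφ
  have hN := (hψ.mul (hψ.comp_sub_const h)).const_mul (1 - b)
  rwa [add_zero, ← two_mul] at hN

theorem stripBounded_quadraticTerm_self (H : IsMonotoneFront b c h φ ψ) (hφ : ExpBounded y φ) :
    StripBounded 0 y (quadraticTerm b h ψ) := by
  have hN := H.stripBounded_quadraticTerm hφ
  have hle : quadraticTerm b h ψ =O[⊤] ψ := isBigO_top.2 ⟨1, fun t => by
    rw [Real.norm_of_nonneg (H.quadraticTerm_nonneg t), Real.norm_of_nonneg (H.psi_nonneg t),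
      one_mul]
    exact H.quadraticTerm_le_psi t⟩
  exact ⟨hN.continuous, hN.left, hle.trans (H.stripBounded_psi hφ).right⟩

theorem tail_identity (H : IsMonotoneFront b c h φ ψ) (hφ : ExpBounded y φ) (hy : y < x) (t : ℝ) :
    (x ^ 2 - c * x) * (∫ s in Ioi t, Real.exp (-x * s) * φ s)
        + ∫ s in Ioi t, Real.exp (-x * s) * ψ s
      = (∫ s in Ioi t, Real.exp (-x * s) * quadraticTerm b h ψ s)
        + Real.exp (-x * t) * (deriv φ t + (x - c) * φ t) := by
  have hiφ := hφ.integrableOn_Ioi H.contDiff.continuous hy t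
  have hiψ := (H.stripBounded_psi hφ).right.integrableOn_Ioi H.continuous_psi hy t
  have hid := (H.stripBounded_deriv hφ).right.integrableOn_Ioi H.continuous_deriv hy t
  have hiN := (H.stripBounded_quadraticTerm_self hφ).right.integrableOn_Ioi
    (H.stripBounded_quadraticTerm_self hφ).continuous hy t
  set N := quadraticTerm b h ψ
  have hP : ∀ s, HasDerivAt (fun s => Real.exp (-x * s) * (deriv φ s + (x - c) * φ s))
      (Real.exp (-x * s) * N s - Real.exp (-x * s) * ψ s
        - (x ^ 2 - c * x) * (Real.exp (-x * s) * φ s)) s := fun s => by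
    refine (((hasDerivAt_id s).const_mul (-x)).exp.mul ((H.hasDerivAt_deriv s).add
      ((H.hasDerivAt s).const_mul (x - c)))).congr_deriv ?_
    simp only [id, Pi.add_apply, H.deriv_deriv_eq s]
    ring
  have hiP' := (hiN.fun_sub hiψ).fun_sub (hiφ.const_mul (x ^ 2 - c * x))
  have hiP : IntegrableOn (fun s => Real.exp (-x * s) * (deriv φ s + (x - c) * φ s)) (Ioi t) :=
    (hid.add (hiφ.const_mul (x - c))).congr_fun (fun s _ => by simp only [Pi.add_apply]; ring)
      measurableSet_Ioi
  have hint := integral_Ioi_of_hasDerivAt_of_tendsto' (fun s _ => hP s) hiP'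
    (tendsto_zero_of_hasDerivAt_of_integrableOn_Ioi (fun s _ => hP s) hiP' hiP)
  rw [integral_sub (hiN.fun_sub hiψ) (hiφ.const_mul _), integral_sub hiN hiψ,
    integral_const_mul] at hint
  linarith

theorem tail_psi_ge (H : IsMonotoneFront b c h φ ψ) (hφ : ExpBounded y φ) (hy : y < x)
    (hx : 0 ≤ x) (t : ℝ) :
    (1 - b * Real.exp (-x * h))⁻¹ * (∫ s in Ioi t, Real.exp (-x * s) * φ s)
      ≤ ∫ s in Ioi t, Real.exp (-x * s) * ψ s := by
  have hψ := (H.stripBounded_psi hφ).right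
  have hi := hψ.integrableOn_Ioi H.continuous_psi hy
  have hi' := (hψ.comp_sub_const h).integrableOn_Ioi
    (H.continuous_psi.comp (continuous_sub_right h)) hy t
  have hshift : ∫ s in Ioi t, Real.exp (-x * s) * ψ (s - h)
      = Real.exp (-x * h) * ∫ s in Ioi (t - h), Real.exp (-x * s) * ψ s := by
    rw [← setIntegral_Ioi_comp_sub (fun s => Real.exp (-x * s) * ψ s), ← integral_const_mul]
    refine integral_congr_ae (Eventually.of_forall fun s => ?_)
    simp only
    rw [← mul_assoc, ← Real.exp_add]
    ring_nf
  have hsplit : ∫ s in Ioi t, Real.exp (-x * s) * ψ s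
      = (∫ s in Ioi t, Real.exp (-x * s) * φ s)
        + b * ∫ s in Ioi t, Real.exp (-x * s) * ψ (s - h) := by
    rw [← integral_const_mul, ← integral_add (hφ.integrableOn_Ioi H.contDiff.continuous hy t)
      (hi'.const_mul b)]
    refine integral_congr_ae (Eventually.of_forall fun s => ?_)
    simp only [H.psi_eq s]
    ring
  have hmono : ∫ s in Ioi t, Real.exp (-x * s) * ψ s
      ≤ ∫ s in Ioi (t - h), Real.exp (-x * s) * ψ s :=
    setIntegral_mono_set (hi _) (Eventually.of_forall fun s =>
      mul_nonneg (Real.exp_pos _).le (H.psi_nonneg s))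
      (Ioi_subset_Ioi (sub_le_self t H.h_nonneg)).eventuallyLE
  rw [inv_mul_le_iff₀ (one_sub_mul_exp_pos H.b_nonneg H.b_lt_one H.h_nonneg hx)]
  have := mul_le_mul_of_nonneg_left hmono
    (mul_nonneg H.b_nonneg (Real.exp_pos (-x * h)).le)
  rw [hshift] at hsplit
  linarith

/-- `θ` is the fraction of `ψ` that absorbs the quadratic term. By `tail_identity`, the tail
`I t = ∫ s > t, e^{-x s} φ s` then satisfies `m I ≤ ∫ G - x I'`, where `m > x (x - y)` is the right
side of `hκ`; since `I = O(e^{(y - x) t})`, this forces `I ≤ (∫ G) / m`. -/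
theorem expBounded_of_quadraticTerm_le (H : IsMonotoneFront b c h φ ψ) (hφ : ExpBounded y φ)
    (hx : 0 < x) (hy : y < x) {θ : ℝ} (hθ : θ ≤ 1) {G : ℝ → ℝ} (hG : Integrable G)
    (hG0 : ∀ s, 0 ≤ G s)
    (hN : ∀ s, Real.exp (-x * s) * quadraticTerm b h ψ s ≤ θ * (Real.exp (-x * s) * ψ s) + G s)
    (hκ : x * (x - y) < x ^ 2 - c * x + (1 - θ) * (1 - b * Real.exp (-x * h))⁻¹) :
    ExpBounded x φ := by
  have hiφ := hφ.integrableOn_Ioi H.contDiff.continuous hy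
  have hiψ := (H.stripBounded_psi hφ).right.integrableOn_Ioi H.continuous_psi hy
  have hiN := (H.stripBounded_quadraticTerm_self hφ).right.integrableOn_Ioi
    (H.stripBounded_quadraticTerm_self hφ).continuous hy
  set m := x ^ 2 - c * x + (1 - θ) * (1 - b * Real.exp (-x * h))⁻¹
  set I : ℝ → ℝ := fun t => ∫ s in Ioi t, Real.exp (-x * s) * φ s
  have hm : 0 < m := (mul_pos hx (sub_pos.2 hy)).trans hκ
  have htail : ∀ t, m * I t ≤ (∫ s, G s) + x * (Real.exp (-x * t) * φ t) := fun t => by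
    have hNle : ∫ s in Ioi t, Real.exp (-x * s) * quadraticTerm b h ψ s
        ≤ θ * (∫ s in Ioi t, Real.exp (-x * s) * ψ s) + ∫ s, G s := by
      refine (setIntegral_mono (hiN t) (((hiψ t).const_mul θ).add hG.integrableOn) hN).trans ?_
      simp only [Pi.add_apply]
      rw [integral_add ((hiψ t).const_mul θ) hG.integrableOn, integral_const_mul]
      exact add_le_add_right (setIntegral_le_integral hG (Eventually.of_forall hG0)) _
    have hψ := mul_le_mul_of_nonneg_left (H.tail_psi_ge hφ hy hx.le t) (sub_nonneg.2 hθ)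
    have hflux := mul_le_mul_of_nonneg_left (H.deriv_le t) (Real.exp_pos (-x * t)).le
    linarith [H.tail_identity hφ hy t]
  obtain ⟨C, -, hC⟩ := ((hφ.exp_mul (-x)).integral_Ioi (by linarith)).exists_le
  refine expBounded_of_integral_exp_mul_le (K := (∫ s, G s) / m) H.mono H.nonneg hx hiφ
    fun t => sub_nonpos.1 ?_
  refine nonpos_of_deriv_le_mul (a := -m / x) (ρ := -x + y) (C := C)
    (fun s => (hasDerivAt_integral_Ioi (by have := H.contDiff.continuous; fun_prop) hiφ s).sub_const
      ((∫ s, G s) / m)) (fun s => ?_) ?_ (fun s => ?_) t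
  · rw [div_mul_eq_mul_div, le_div_iff₀ hx, neg_mul m, mul_sub, mul_div_cancel₀ _ hm.ne']
    linarith [htail s]
  · rw [div_lt_iff₀ hx]
    linarith
  · have hdiv : 0 ≤ (∫ s, G s) / m := div_nonneg (integral_nonneg hG0) hm.le
    linarith [le_abs_self (I s), hC s]

theorem exists_expBounded (H : IsMonotoneFront b c h φ ψ) : ∃ x, 0 < x ∧ ExpBounded x φ := by
  have hc := H.c_pos
  have hx : 0 < 1 / (4 * c) := by positivity
  set x := 1 / (4 * c) with hxdef
  have hcx : c * x = 1 / 4 := by rw [hxdef]; field_simp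
  have hsmall : ∀ᶠ s in atBot, (1 - b) * ψ s < 1 / 2 := by
    have hlim := H.tendsto_psi_atBot.const_mul (1 - b)
    rw [mul_zero] at hlim
    exact hlim.eventually_lt_const one_half_pos
  obtain ⟨t₀, ht₀⟩ := eventually_atBot.1 hsmall
  refine ⟨x, hx, H.expBounded_of_quadraticTerm_le H.expBounded_zero hx hx (θ := 1 / 2)
    one_half_lt_one.le
    (G := (Ioi t₀).indicator fun s => (1 - b)⁻¹ * Real.exp (-x * s)) ?_ ?_ (fun s => ?_) ?_⟩
  · exact (integrable_indicator_iff measurableSet_Ioi).2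
      ((integrableOn_exp_mul_Ioi (neg_lt_zero.2 hx) t₀).const_mul _)
  · exact indicator_nonneg fun s _ =>
      mul_nonneg (inv_nonneg.2 H.one_sub_b_pos.le) (Real.exp_pos _).le
  · have hexp := (Real.exp_pos (-x * s)).le
    rcases le_or_gt s t₀ with hs | hs
    · rw [indicator_of_notMem (notMem_Ioi.2 hs), add_zero, mul_left_comm]
      refine mul_le_mul_of_nonneg_left ?_ hexp
      have hhalf := mul_le_mul_of_nonneg_left
        (ht₀ (s - h) ((sub_le_self s H.h_nonneg).trans hs)).le (H.psi_nonneg s)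
      unfold quadraticTerm
      linarith
    · rw [indicator_of_mem (mem_Ioi.2 hs), mul_comm (1 - b)⁻¹]
      have hle : quadraticTerm b h ψ s ≤ (1 - b)⁻¹ := (H.quadraticTerm_le_psi s).trans
        ((H.psi_le s).trans (mul_le_of_le_one_right (inv_nonneg.2 H.one_sub_b_pos.le)
          (H.le_one s)))
      exact (mul_le_mul_of_nonneg_left hle hexp).trans (le_add_of_nonneg_left
        (mul_nonneg one_half_pos.le (mul_nonneg hexp (H.psi_nonneg s))))
  · have hκ : 1 ≤ (1 - b * Real.exp (-x * h))⁻¹ :=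
      (one_le_inv₀ (one_sub_mul_exp_pos H.b_nonneg H.b_lt_one H.h_nonneg hx.le)).2
        (sub_le_self _ (mul_nonneg H.b_nonneg (Real.exp_pos _).le))
    linarith

theorem expBounded_of_chiReal_pos (H : IsMonotoneFront b c h φ ψ) {x₁ : ℝ} (hx₁ : 0 < x₁)
    (hpos : ∀ x ∈ Icc 0 x₁, 0 < chiReal b c h x) : ExpBounded x₁ φ := by
  obtain ⟨δ₀, hδ₀, hφ₀⟩ := H.exists_expBounded
  have hδ : 0 < min δ₀ x₁ := lt_min hδ₀ hx₁
  obtain ⟨x', hx', hmin⟩ := isCompact_Icc.exists_isMinOn (nonempty_Icc.2 hx₁.le)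
    ((continuousOn_chiReal H.b_nonneg H.b_lt_one H.h_nonneg).mono Icc_subset_Ici_self)
  set m := chiReal b c h x'
  have hm : 0 < m := hpos x' hx'
  refine of_step_of_le (P := fun x => ExpBounded x φ)
    (η := min (min δ₀ x₁ / 2) (m / (2 * x₁))) (lt_min (by positivity) (by positivity))
    (H.expBounded_zero.interpolate hφ₀ hδ.le (min_le_left _ _)) (min_le_right _ _)
    fun y x hy hyx hxy hxx hφ => ?_
  have hy0 : 0 < y := hδ.trans_le hy
  have hx : 0 < x := hy0.trans hyx
  have hx2y : x < 2 * y := by linarith [min_le_left (min δ₀ x₁ / 2) (m / (2 * x₁))]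
  have hN := H.stripBounded_quadraticTerm hφ
  refine H.expBounded_of_quadraticTerm_le hφ hx hyx zero_le_one (hN.integrable ⟨hx, hx2y⟩)
    (fun s => mul_nonneg (Real.exp_pos _).le (H.quadraticTerm_nonneg s))
    (fun s => by rw [zero_mul, zero_add]) ?_
  rw [sub_zero, one_mul]
  calc x * (x - y) ≤ x₁ * (m / (2 * x₁)) :=
        mul_le_mul hxx (by linarith [min_le_right (min δ₀ x₁ / 2) (m / (2 * x₁))])
          (sub_pos.2 hyx).le hx₁.le
    _ = m / 2 := by field_simp
    _ < m := half_lt_self hm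
    _ ≤ chiReal b c h x := hmin ⟨hx.le, hxx⟩

theorem exists_chiReal_nonpos (H : IsMonotoneFront b c h φ ψ) :
    ∃ x ∈ Icc 0 c, chiReal b c h x ≤ 0 := by
  by_contra! hpos
  have hpos' : ∀ x ∈ Icc 0 (c + 1), 0 < chiReal b c h x := fun x hx => by
    rcases le_or_gt x c with hxc | hxc
    · exact hpos x ⟨hx.1, hxc⟩
    · have hinv := inv_pos.2 (one_sub_mul_exp_pos H.b_nonneg H.b_lt_one H.h_nonneg hx.1)
      unfold chiReal
      linarith [mul_pos (H.c_pos.trans hxc) (sub_pos.2 hxc)]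
  obtain ⟨C, -, hC⟩ :=
    (H.expBounded_of_chiReal_pos (add_pos H.c_pos one_pos) hpos').exists_le
  exact (H.pos 0).not_ge (nonpos_of_deriv_le_mul H.hasDerivAt H.deriv_le (lt_add_one c)
    (fun t => (le_abs_self _).trans (hC t)) 0)

theorem expBounded_of_lt (H : IsMonotoneFront b c h φ ψ) {l₂ l₁ μ : ℝ}
    (hl : IsPositiveZeroPair (chiReal b c h) l₂ l₁) (hμ : 0 < μ) (hμl : μ < l₂) :
    ExpBounded μ φ :=
  H.expBounded_of_chiReal_pos hμ fun x hx => hl.pos_of_lt x hx.1 (hx.2.trans_lt hμl)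

end IsMonotoneFront

end Growth

section LaplaceIdentity

namespace IsMonotoneFront

variable {b c h l μ : ℝ} {φ ψ : ℝ → ℝ}

theorem laplace_identity (H : IsMonotoneFront b c h φ ψ) (hφ : ExpBounded μ φ) {z : ℂ}
    (hz : z.re ∈ Ioo 0 μ) :
    chi b c h z * laplace φ z = laplace (quadraticTerm b h ψ) z := by
  have hiφ := (H.stripBounded hφ).integrable hz
  have hψ := H.stripBounded_psi hφ
  have hid := (H.stripBounded_deriv hφ).integrable hz
  have hN := H.stripBounded_quadraticTerm_self hφ
  have hdd : deriv (deriv φ) = fun t => c * deriv φ t - ψ t + quadraticTerm b h ψ t :=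
    funext H.deriv_deriv_eq
  have hlin := ((H.stripBounded_deriv hφ).const_mul c).sub hψ
  have hL₁ : laplace (deriv φ) z = z * laplace φ z := laplace_deriv H.hasDerivAt hiφ hid
  have hL₂ : laplace (deriv (deriv φ)) z = z * laplace (deriv φ) z :=
    laplace_deriv H.hasDerivAt_deriv hid (by rw [hdd]; exact (hlin.add hN).integrable hz)
  rw [hdd, laplace_add (hlin.integrable hz) (hN.integrable hz),
    laplace_sub (((H.stripBounded_deriv hφ).const_mul c).integrable hz) (hψ.integrable hz),
    laplace_const_mul, hL₁] at hL₂
  have hLψ : laplace ψ z = laplace φ z + b * (Complex.exp (-z * h) * laplace ψ z) := by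
    rw [← laplace_comp_sub_const, ← laplace_const_mul,
      ← laplace_add hiφ (((hψ.comp_sub_const h).const_mul b).integrable hz)]
    exact congrArg (laplace · z) (funext H.psi_eq)
  have hinv : laplace ψ z = (1 - b * Complex.exp (-z * h))⁻¹ * laplace φ z := by
    rw [eq_inv_mul_iff_mul_eq₀
      (one_sub_mul_cexp_ne_zero H.b_nonneg H.b_lt_one H.h_nonneg hz.1.le)]
    linear_combination hLψ
  unfold chi
  linear_combination -hL₂ - hinv

theorem laplace_quadraticTerm_ne_zero (H : IsMonotoneFront b c h φ ψ) (hφ : ExpBounded μ φ) {x : ℝ}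
    (hx : x ∈ Ioo 0 (2 * μ)) : laplace (quadraticTerm b h ψ) x ≠ 0 := by
  have hpos : ∀ t, 0 < Real.exp (-x * t) * quadraticTerm b h ψ t := fun t =>
    mul_pos (Real.exp_pos _) (H.quadraticTerm_pos t)
  rw [laplace_ofReal, Complex.ofReal_ne_zero]
  refine ((integral_pos_iff_support_of_nonneg (fun t => (hpos t).le)
    ((H.stripBounded_quadraticTerm hφ).integrable hx)).2 ?_).ne'
  rw [Function.support_eq_univ fun t => (hpos t).ne']
  exact Measure.measure_univ_pos.2 NeZero.out

theorem not_expBounded (H : IsMonotoneFront b c h φ ψ) (hl : 0 < l) (h0 : chiReal b c h l = 0)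
    (hμ : l < μ) : ¬ ExpBounded μ φ := fun hφ => by
  have hid := H.laplace_identity hφ (z := l) ⟨hl, hμ⟩
  rw [chi_ofReal, h0, Complex.ofReal_zero, zero_mul] at hid
  exact H.laplace_quadraticTerm_ne_zero hφ ⟨hl, by linarith⟩ hid.symm

/-- At a double zero `l` of `chi`, `chi x * laplace φ x → 0` as `x ↑ l`, since the transform of an
`O(exp (l t))` function blows up no faster than `(l - x)⁻¹`. -/
theorem not_expBounded_of_deriv_eq_zero (H : IsMonotoneFront b c h φ ψ) (hl : 0 < l)
    (h0 : chiReal b c h l = 0) (hd : deriv (chiReal b c h) l = 0) : ¬ ExpBounded l φ := fun hφ => by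
  have hχ : (fun x : ℝ => chi b c h x) =o[𝓝[<] l] fun x => x - l := by
    have hderiv := (differentiableAt_chiReal (c := c) H.b_nonneg H.b_lt_one H.h_nonneg
      hl.le).hasDerivAt.isLittleO
    simp only [h0, hd, smul_zero, sub_zero] at hderiv
    refine (isLittleO_norm_left.1 ?_).mono nhdsWithin_le_nhds
    simpa only [chi_ofReal, Complex.norm_real] using hderiv.norm_left
  have hprod : Tendsto (fun x : ℝ => chi b c h x * laplace φ x) (𝓝[<] l) (𝓝 0) := by
    refine (isLittleO_one_iff ℝ).1
      ((hχ.mul_isBigO ((H.stripBounded hφ).laplace_isBigO_left hl)).congr' .rfl ?_)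
    filter_upwards [self_mem_nhdsWithin] with x hx
    exact mul_inv_cancel₀ (sub_ne_zero.2 (ne_of_lt hx))
  have hlN : l ∈ Ioo 0 (2 * l) := ⟨hl, by linarith⟩
  have hN : ContinuousAt (laplace (quadraticTerm b h ψ)) (l : ℂ) :=
    ((H.stripBounded_quadraticTerm hφ).differentiableOn_laplace.differentiableAt
      ((isOpen_Ioo.preimage Complex.continuous_re).mem_nhds hlN)).continuousAt
  have hlim : Tendsto (fun x : ℝ => laplace (quadraticTerm b h ψ) x) (𝓝[<] l)
      (𝓝 (laplace (quadraticTerm b h ψ) l)) :=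
    (hN.tendsto.comp Complex.continuous_ofReal.continuousAt).mono_left nhdsWithin_le_nhds
  refine H.laplace_quadraticTerm_ne_zero hφ hlN
    (tendsto_nhds_unique (hlim.congr' ?_) hprod)
  filter_upwards [Ioo_mem_nhdsLT hl] with x hx
  exact (H.laplace_identity hφ (z := x) hx).symm

theorem exists_expBounded_iterate_reduceMode (H : IsMonotoneFront b c h φ ψ) {l₂ l₁ : ℝ} {m : ℕ}
    (hl : IsPositiveZeroPair (chiReal b c h) l₂ l₁)
    (hord : analyticOrderAt (chi b c h) l₂ = m) :
    ∃ x, l₂ < x ∧ ExpBounded x ((reduceMode l₂)^[m] φ) := by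
  have h0 := hl.pos
  obtain ⟨ε, hε, hzero⟩ := exists_strip_chi_ne_zero H.b_nonneg H.b_lt_one H.h_nonneg h0
    hl.eq_zero_left (by rw [hord]; exact ENat.natCast_ne_top m)
  have hδ : 0 < min ε (l₂ / 8) := lt_min hε (by positivity)
  set δ := min ε (l₂ / 8)
  have hδε : δ ≤ ε := min_le_left _ _
  have hδl : δ ≤ l₂ / 8 := min_le_right _ _
  have hφ : ExpBounded (l₂ - δ / 2) φ := H.expBounded_of_lt hl (by linarith) (by linarith)
  have hstrip := (H.stripBounded hφ).mono (ν₁ := l₂ - 2 * δ) (by linarith) (by linarith) le_rfl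
  refine ⟨l₂ + δ, by linarith, hstrip.expBounded_iterate_reduceMode (x₀ := l₂ - δ) H.b_nonneg
    H.b_lt_one H.h_nonneg (H.stripBounded_quadraticTerm hφ) (by linarith)
    ⟨by linarith, by linarith⟩ (by linarith) (by linarith) ⟨by linarith, by linarith⟩ hord
    (fun z hz => hzero z (abs_le.2 ⟨by linarith [hz.1], by linarith [hz.2]⟩))
    fun z hz => H.laplace_identity hφ ?_⟩
  rw [hz]
  exact ⟨by linarith, by linarith⟩

end IsMonotoneFront

end LaplaceIdentity

section Expansion

/-- `φ (t + tₐ) = exp (l t) ((-t)ʲ + j d + o(exp (ε t)))` as `t → -∞`, for some `ε > 0`, `tₐ`, `d`;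
the translation by `tₐ` normalizes the leading coefficient. -/
def HasNormalizedExpansion (φ : ℝ → ℝ) (l : ℝ) (j : ℕ) : Prop :=
  ∃ ε : ℝ, 0 < ε ∧ ∃ (tₐ d : ℝ) (r : ℝ → ℝ),
    r =o[atBot] (fun t : ℝ => Real.exp (ε * t)) ∧
    ∀ t : ℝ, φ (t + tₐ) = Real.exp (l * t) * ((-t) ^ j + j * d + r t)

theorem hasNormalizedExpansion_of_expBounded {φ : ℝ → ℝ} {l x K d : ℝ} {j : ℕ} (hl : l ≠ 0)
    (hx : l < x) (hK : 0 < K) (hj : j ≤ 1)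
    (h : ExpBounded x fun t => φ t - K * ((-t) ^ j + j * d) * Real.exp (l * t)) :
    HasNormalizedExpansion φ l j := by
  set R := fun t => φ t - K * ((-t) ^ j + j * d) * Real.exp (l * t)
  obtain ⟨s, hs⟩ : ∃ s, K * Real.exp (l * s) = 1 := by
    refine ⟨-Real.log K / l, ?_⟩
    rw [mul_div_cancel₀ _ hl, Real.exp_neg, Real.exp_log hK, mul_inv_cancel₀ hK.ne']
  have hr : ExpBounded (-l + x) fun t => Real.exp (-l * t) * R (t - -s) :=
    (h.comp_sub_const (-s)).exp_mul (-l)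
  refine ⟨(x - l) / 2, by linarith, s, d - s, _, hr.isLittleO_atBot (by linarith), fun t => ?_⟩
  have hpoly : (-(t + s)) ^ j + j * d = (-t) ^ j + j * (d - s) := by
    interval_cases j
    · simp
    · push_cast
      ring
  calc φ (t + s)
      = K * Real.exp (l * s) * Real.exp (l * t) * ((-(t + s)) ^ j + j * d) + R (t + s) := by
        rw [mul_assoc K, ← Real.exp_add]
        simp only [R]
        ring_nf
    _ = Real.exp (l * t) * ((-t) ^ j + j * (d - s) + Real.exp (-l * t) * R (t - -s)) := by
        have hexp : Real.exp (l * t) * Real.exp (-l * t) = 1 := by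
          rw [neg_mul, ← Real.exp_add, add_neg_cancel, Real.exp_zero]
        rw [hs, hpoly, sub_neg_eq_add]
        linear_combination -R (t + s) * hexp

theorem eventually_neg_lt_of_expBounded_sub {f p : ℝ → ℝ} {l x δ : ℝ} (h0 : ∀ t, 0 ≤ f t)
    (hx : l < x) (h : ExpBounded x fun t => f t - p t * Real.exp (l * t)) (hδ : 0 < δ) :
    ∀ᶠ t in atBot, -δ < p t := by
  have hlim := (h.exp_mul (-l)).isLittleO_atBot (ν := 0) (by linarith)
  simp only [zero_mul, Real.exp_zero] at hlim
  filter_upwards [((isLittleO_one_iff ℝ).1 hlim).eventually_lt_const hδ] with t ht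
  rw [mul_sub, mul_left_comm, ← Real.exp_add, neg_mul, neg_add_cancel, Real.exp_zero, mul_one] at ht
  linarith [mul_nonneg (Real.exp_pos (-(l * t))).le (h0 t)]

namespace IsMonotoneFront

variable {b c h l₂ l₁ : ℝ} {φ ψ : ℝ → ℝ}

theorem hasNormalizedExpansion_of_lt (H : IsMonotoneFront b c h φ ψ)
    (hl : IsPositiveZeroPair (chiReal b c h) l₂ l₁) (hlt : l₂ < l₁) :
    HasNormalizedExpansion φ l₂ 0 := by
  have hord : analyticOrderAt (chi b c h) l₂ = (1 : ℕ) := by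
    rw [analyticOrderAt_chi_eq H.b_nonneg H.b_lt_one H.h_nonneg hl hl.pos, if_pos rfl,
      if_neg hlt.ne, add_zero, Nat.cast_one]
  obtain ⟨x, hx, hred⟩ := H.exists_expBounded_iterate_reduceMode hl hord
  have hμ := half_pos hl.pos
  obtain ⟨B, hB⟩ := (H.expBounded_of_lt hl hμ (half_lt_self hl.pos)).expansion_of_reduceMode
    (a := 0) H.contDiff.continuous hμ hx (by simpa using hred)
  simp only [mul_zero, zero_mul, zero_add] at hB
  have hB0 : 0 ≤ B := le_of_forall_pos_lt_add fun δ hδ => by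
    linarith [(eventually_neg_lt_of_expBounded_sub H.nonneg hx hB hδ).exists.choose_spec]
  have hBne : B ≠ 0 := by
    rintro rfl
    exact H.not_expBounded hl.pos hl.eq_zero_left hx (by simpa using hB)
  exact hasNormalizedExpansion_of_expBounded (K := B) (d := 0) hl.pos.ne' hx
    (hB0.lt_of_ne' hBne) zero_le_one (by simpa using hB)

theorem hasNormalizedExpansion_of_eq (H : IsMonotoneFront b c h φ ψ)
    (hl : IsPositiveZeroPair (chiReal b c h) l₂ l₁) (heq : l₂ = l₁) :
    HasNormalizedExpansion φ l₂ 1 := by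
  have hord : analyticOrderAt (chi b c h) l₂ = (2 : ℕ) := by
    rw [analyticOrderAt_chi_eq H.b_nonneg H.b_lt_one H.h_nonneg hl hl.pos, if_pos rfl,
      if_pos heq, one_add_one_eq_two, Nat.cast_two]
  obtain ⟨x, hx, hred⟩ := H.exists_expBounded_iterate_reduceMode hl hord
  have hμ := half_pos hl.pos
  have hφ := H.stripBounded (H.expBounded_of_lt hl hμ (half_lt_self hl.pos))
  have hφ' := (hφ.mono hμ.le le_rfl le_rfl).reduceMode hμ hμ l₂
  obtain ⟨A, hA⟩ := hφ'.right.expansion_of_reduceMode (a := 0) hφ'.continuous hμ hx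
    (by simpa using hred)
  simp only [mul_zero, zero_mul, zero_add] at hA
  obtain ⟨B, hB⟩ := hφ.right.expansion_of_reduceMode hφ.continuous hμ hx hA
  have hA0 : A ≤ 0 := by
    by_contra! hpos
    have hbot : Tendsto (fun t => l₂ * A * t + B) atBot atBot :=
      tendsto_atBot_add_const_right _ B (tendsto_id.const_mul_atBot (mul_pos hl.pos hpos))
    obtain ⟨t, ht, ht'⟩ := ((eventually_neg_lt_of_expBounded_sub H.nonneg hx hB one_pos).and
      (hbot.eventually_le_atBot (-1))).exists
    exact ht.not_ge ht'
  have hAne : A ≠ 0 := by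
    rintro rfl
    simp only [mul_zero, zero_mul, zero_add] at hB
    exact H.not_expBounded_of_deriv_eq_zero hl.pos hl.eq_zero_left (hl.deriv_eq_zero heq)
      (H.expBounded_zero.of_sub_mul_exp hl.pos.le hx.le hB)
  have hK : 0 < -(l₂ * A) := neg_pos.2 (mul_neg_of_pos_of_neg hl.pos (hA0.lt_of_ne hAne))
  refine hasNormalizedExpansion_of_expBounded (d := B / -(l₂ * A)) hl.pos.ne' hx hK le_rfl ?_
  simpa only [pow_one, Nat.cast_one, one_mul, mul_add, mul_div_cancel₀ _ hK.ne', neg_mul_neg]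
    using hB

end IsMonotoneFront

end Expansion

theorem lemma2p4 (b c τ : ℝ) (hb0 : 0 ≤ b) (hb1 : b < 1) (hc : 0 < c) (hτ : 0 ≤ τ)
    (φ : ℝ → ℝ) (hφ : IsProfileSolution b c τ φ)
    (hmono : Monotone φ ∨ Antitone φ)
    (hbdd : ∃ M : ℝ, ∀ t : ℝ, |φ t| ≤ M)
    (hnonconst : ¬ ∃ k : ℝ, ∀ t : ℝ, φ t = k) :
    (∀ t : ℝ, 0 < deriv φ t) ∧
    ∃ l₂ l₁ : ℝ, 0 < l₂ ∧ l₂ ≤ l₁ ∧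
      -- the positive zeros of `χ₀`, counted with multiplicity, are exactly `l₂` and `l₁`
      (∀ x : ℝ, 0 < x →
        analyticOrderAt (chi0 b c τ) (x : ℂ)
          = (if x = l₂ then 1 else 0) + (if x = l₁ then 1 else 0)) ∧
      ∃ j : ℕ, (l₂ < l₁ → j = 0) ∧ (l₂ = l₁ → j = 1) ∧
        ∃ ε : ℝ, 0 < ε ∧ ∃ (tₐ d : ℝ) (r : ℝ → ℝ),
          r =o[atBot] (fun t : ℝ => Real.exp (ε * t)) ∧
          ∀ t : ℝ, φ (t + tₐ) = Real.exp (l₂ * t) * ((-t) ^ j + j * d + r t) := by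
  have hφmono : Monotone φ := hmono.resolve_right fun hanti => zero_lt_one.not_ge
    ((hanti.le_of_tendsto hφ.tendsto_atTop 0).trans (hanti.ge_of_tendsto hφ.tendsto_atBot 0))
  have H := hφ.isMonotoneFront hb0 hb1 hc hτ hφmono
  obtain ⟨l₂, l₁, hl⟩ :=
    exists_isPositiveZeroPair_chiReal hb0 hb1 hc H.h_nonneg H.exists_chiReal_nonpos
  refine ⟨H.deriv_pos, l₂, l₁, hl.pos, hl.le, fun x hx => ?_, ?_⟩
  · rw [chi0_eq_chi]
    exact analyticOrderAt_chi_eq hb0 hb1 H.h_nonneg hl hx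
  · rcases hl.le.eq_or_lt with heq | hlt
    · exact ⟨1, fun hlt => absurd heq hlt.ne, fun _ => rfl, H.hasNormalizedExpansion_of_eq hl heq⟩
    · exact ⟨0, fun _ => rfl, fun heq => absurd heq hlt.ne, H.hasNormalizedExpansion_of_lt hl hlt⟩
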